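/- All graphs are finite and simple. A signed graph $\Gamma=(G,\sigma)$ is a graph $G$ with a map $\sigma:E(G)\to\{+1,-1\}$; its adjacency matrix has entry $\sigma(xy)$ at adjacent pairs $x,y$ and $0$ elsewhere. $\Gamma$ is spectrally symmetric if for each eigenvalue $\lambda$ of its adjacency matrix, $-\lambda$ is also an eigenvalue, with the same multiplicity. Switching with respect to $U\subseteq V(G)$ reverses the signs of all edges between $U$ and $V(G)\setminus U$; signed graphs on $G$ obtained from one another in this way are switching equivalent. $\Gamma$ is sign-symmetric if some automorphism of $G$ is a sign-preserving isomorphism from $\Gamma$ to a switching of $-\Gamma=(G,-\sigma)$. A graph $G$ is bicyclic if it is connected and $|E(G)|=|V(G)|+1$; it is a base bicyclic graph if moreover no proper subgraph of $G$ is bicyclic. Let $\theta(u,v;l_1,l_2,l_3)$ denote the graph that consists of three paths of lengths $l_1,l_2,l_3$ with common end points $u\ne v$, which share no edge and no other vertex; $\infty(u;l_1,l_2)$ the graph that consists of two cycles of lengths $l_1,l_2$ with exactly the vertex $u$ in common; and $\bowtie(u,v;l,l_1,l_2)$ the graph that consists of two disjoint cycles of lengths $l_1,l_2$, the first through $u$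 and the second through $v$, joined by a path of length $l\ge 1$ from $u$ to $v$ that meets the cycles only in its end points. A superscript $-$ on a length means that exactly one edge of that path or cycle is negative; all edges of paths and cycles without superscript are positive. Let - $\mathfrak{B}_\theta$ be the set of signed graphs that are switching equivalent to some $\theta(u,v;l_1,l_2^-,l_2)$ with $l_1,l_2\ge 1$ of opposite parity; - $\mathfrak{B}_\infty$ be the set of those switching equivalent to some $\infty(u;(2i+1)^-,2i+1)$ with $i\ge 1$; - $\mathfrak{B}_{\bowtie}$ be the set of those switching equivalent to some $\bowtie(u,v;l,(2i+1)^-,2i+1)$ with $l,i\ge 1$; and let $\mathfrak{B}=\mathfrak{B}_\theta\cup\mathfrak{B}_\infty\cup\mathfrak{B}_{\bowtie}$. Proposition. Let $G$ be a non-bipartite base bicyclic graph and $\Gamma=(G,\sigma)$ a signed graph on $G$. Then the following are equivalent: 1. $\Gamma$ is spectrally symmetric; 2. $\Gamma\in\mathfrak{B}$; 3. $\Gamma$ is sign-symmetric. -/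

import Mathlib

namespace SignedBicyclic

universe u

variable {V : Type u}

/-! ### Signed graphs -/

/-- A signature of `G`: a map from the edges to `{+1, -1}`. The signed graph `Γ = (G, σ)` is
represented by the graph `G` together with `σ : Signature G`. -/
abbrev Signature (G : SimpleGraph V) : Type u := G.edgeSet → ℤˣ

namespace Signature

variable {G : SimpleGraph V}

/-- The adjacency matrix of `(G, σ)`: the entry at an adjacent pair is the sign of the edge, all
other entries are `0`. -/
noncomputable def adjMatrix (σ : Signature G) : Matrix V V ℝ := fun x y => by
  classical
  exact if h : G.Adj x y then (((σ ⟨s(x, y), h⟩ : ℤˣ) : ℤ) : ℝ) else 0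

/-- The spectrum of `(G, σ)`: the eigenvalues of the (real symmetric) adjacency matrix, listed with
multiplicity. -/
noncomputable def spectrum [Fintype V] (σ : Signature G) : Multiset ℝ := by
  classical
  exact σ.adjMatrix.charpoly.roots

/-- For each eigenvalue `x`, the number `-x` is an eigenvalue of the same multiplicity. -/
def IsSpectrallySymmetric [Fintype V] (σ : Signature G) : Prop :=
  ∀ x ∈ σ.spectrum, -x ∈ σ.spectrum ∧ σ.spectrum.count (-x) = σ.spectrum.count x

/-- Switching with respect to `U`: reverse the signs of the edges that have one end in `U` and the
other end outside `U`. -/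
noncomputable def switch (σ : Signature G) (U : Set V) : Signature G := fun e => by
  classical
  exact if (∃ x ∈ e.1, x ∈ U) ∧ (∃ y ∈ e.1, y ∉ U) then -σ e else σ e

/-- Switching equivalence of two signed graphs on `G`. -/
def SwitchingEquivalent (σ τ : Signature G) : Prop := ∃ U : Set V, τ = σ.switch U

/-- `(G, σ)` and `(G, τ)` are isomorphic: some automorphism of `G` takes the sign of every edge in
`σ` to the sign of its image in `τ`. -/
def Isomorphic (σ τ : Signature G) : Prop :=
  ∃ φ : G ≃g G, ∀ e : G.edgeSet, τ (φ.mapEdgeSet e) = σ e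

/-- `(G, σ)` is isomorphic to some switching of `(G, τ)`. -/
def SwitchingIsomorphic (σ τ : Signature G) : Prop := ∃ U : Set V, σ.Isomorphic (τ.switch U)

/-- The negation `(G, -σ)`, in which the sign of every edge is reversed. -/
def negation (σ : Signature G) : Signature G := fun e => -σ e

/-- `(G, σ)` is switching isomorphic to its negation. -/
def IsSignSymmetric (σ : Signature G) : Prop := σ.SwitchingIsomorphic σ.negation

/-- The set of negative edges. -/
def negEdges (σ : Signature G) : Set (Sym2 V) := {e | ∃ h : e ∈ G.edgeSet, σ ⟨e, h⟩ = -1}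

/-- The decoration `+` or `-` of a path or cycle: with `a = 1`, all of its edges are positive; with
`a = -1`, exactly one of its edges is negative. -/
def HasMark (σ : Signature G) {x y : V} (p : G.Walk x y) (a : ℤˣ) : Prop :=
  {e | e ∈ p.edges ∧ e ∈ σ.negEdges}.ncard = if a = 1 then 0 else 1

end Signature

/-! ### Base bicyclic graphs -/

/-- A (finite) bicyclic graph: connected, with one edge more than vertices. -/
def IsBicyclic (G : SimpleGraph V) : Prop :=
  G.Connected ∧ G.edgeSet.ncard = Nat.card V + 1

/-- A base bicyclic graph: a bicyclic graph that is minimal, in that it is the only one among its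
subgraphs that is bicyclic. -/
def IsBaseBicyclic (G : SimpleGraph V) : Prop :=
  IsBicyclic G ∧ ∀ H : G.Subgraph, IsBicyclic H.coe → H = ⊤

/-- `G` consists of the three paths `p`, `q`, `r` with the two common end points `x` and `y`, which
share no edge and no other vertex. -/
structure ConsistsOfTheta (G : SimpleGraph V) {x y : V} (p q r : G.Walk x y) : Prop where
  ne : x ≠ y
  isPath₁ : p.IsPath
  isPath₂ : q.IsPath
  isPath₃ : r.IsPath
  inter₁₂ : ∀ z, z ∈ p.support → z ∈ q.support → z = x ∨ z = y
  inter₁₃ : ∀ z, z ∈ p.support → z ∈ r.support → z = x ∨ z = y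
  inter₂₃ : ∀ z, z ∈ q.support → z ∈ r.support → z = x ∨ z = y
  disjoint₁₂ : p.edges.Disjoint q.edges
  disjoint₁₃ : p.edges.Disjoint r.edges
  disjoint₂₃ : q.edges.Disjoint r.edges
  vertex : ∀ z, z ∈ p.support ∨ z ∈ q.support ∨ z ∈ r.support
  edge : ∀ e ∈ G.edgeSet, e ∈ p.edges ∨ e ∈ q.edges ∨ e ∈ r.edges

/-- `G` consists of the two cycles `c` and `d`, which have exactly the vertex `x` in common. -/
structure ConsistsOfInfty (G : SimpleGraph V) {x : V} (c d : G.Walk x x) : Prop where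
  isCycle₁ : c.IsCycle
  isCycle₂ : d.IsCycle
  inter : ∀ z, z ∈ c.support → z ∈ d.support → z = x
  vertex : ∀ z, z ∈ c.support ∨ z ∈ d.support
  edge : ∀ e ∈ G.edgeSet, e ∈ c.edges ∨ e ∈ d.edges

/-- `G` consists of the two disjoint cycles `c` (through `x`) and `d` (through `y`), and the path
`p` from `x` to `y`, which meets `c` only in `x` and `d` only in `y`. -/
structure ConsistsOfBowtie (G : SimpleGraph V) {x y : V} (p : G.Walk x y) (c : G.Walk x x)
    (d : G.Walk y y) : Prop where
  isPath : p.IsPath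
  isCycle₁ : c.IsCycle
  isCycle₂ : d.IsCycle
  disjoint : c.support.Disjoint d.support
  inter₁ : ∀ z, z ∈ p.support → z ∈ c.support → z = x
  inter₂ : ∀ z, z ∈ p.support → z ∈ d.support → z = y
  vertex : ∀ z, z ∈ p.support ∨ z ∈ c.support ∨ z ∈ d.support
  edge : ∀ e ∈ G.edgeSet, e ∈ p.edges ∨ e ∈ c.edges ∨ e ∈ d.edges

/-! ### The decorated graphs `θ`, `∞`, `⋈` -/

section Decorated

variable {G : SimpleGraph V}

/-- `(G, σ)` is `θ(x, y; l₁^a, l₂^b, l₃^c)`. -/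
def IsTheta (σ : Signature G) (x y : V) (l₁ : ℕ) (a : ℤˣ) (l₂ : ℕ) (b : ℤˣ) (l₃ : ℕ) (c : ℤˣ) :
    Prop :=
  ∃ p q r : G.Walk x y, ConsistsOfTheta G p q r ∧
    p.length = l₁ ∧ q.length = l₂ ∧ r.length = l₃ ∧
    σ.HasMark p a ∧ σ.HasMark q b ∧ σ.HasMark r c

/-- `(G, σ)` is `∞(x; l₁^a, l₂^b)`. -/
def IsInfty (σ : Signature G) (x : V) (l₁ : ℕ) (a : ℤˣ) (l₂ : ℕ) (b : ℤˣ) : Prop :=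
  ∃ c d : G.Walk x x, ConsistsOfInfty G c d ∧
    c.length = l₁ ∧ d.length = l₂ ∧ σ.HasMark c a ∧ σ.HasMark d b

/-- `(G, σ)` is `⋈(x, y; l^a, l₁^b, l₂^c)`; the path has length `l`. -/
def IsBowtie (σ : Signature G) (x y : V) (l : ℕ) (a : ℤˣ) (l₁ : ℕ) (b : ℤˣ) (l₂ : ℕ) (c : ℤˣ) :
    Prop :=
  ∃ (p : G.Walk x y) (k : G.Walk x x) (k' : G.Walk y y), ConsistsOfBowtie G p k k' ∧
    p.length = l ∧ k.length = l₁ ∧ k'.length = l₂ ∧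
    σ.HasMark p a ∧ σ.HasMark k b ∧ σ.HasMark k' c

end Decorated

/-! ### The family `𝔅`

The decorated graphs are representatives of signed graphs up to switching, so a signed graph belongs
to the family when it is switching equivalent to one of them. -/

/-- `𝔅_θ`: the graphs `θ(x, y; l₁, l₂⁻, l₂)` where `l₁, l₂ ≥ 1` have opposite parity. -/
def familyTheta (G : SimpleGraph V) : Set (Signature G) :=
  {σ | ∃ τ : Signature G, σ.SwitchingEquivalent τ ∧ ∃ (x y : V) (l₁ l₂ : ℕ),
    1 ≤ l₁ ∧ 1 ≤ l₂ ∧ (Even l₁ ↔ Odd l₂) ∧ IsTheta τ x y l₁ 1 l₂ (-1) l₂ 1}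

/-- `𝔅_∞`: the graphs `∞(x; (2i+1)⁻, 2i+1)` where `i ≥ 1`. -/
def familyInfty (G : SimpleGraph V) : Set (Signature G) :=
  {σ | ∃ τ : Signature G, σ.SwitchingEquivalent τ ∧ ∃ (x : V) (i : ℕ),
    1 ≤ i ∧ IsInfty τ x (2 * i + 1) (-1) (2 * i + 1) 1}

/-- `𝔅_⋈`: the graphs `⋈(x, y; l, (2i+1)⁻, 2i+1)` where `l, i ≥ 1`. -/
def familyBowtie (G : SimpleGraph V) : Set (Signature G) :=
  {σ | ∃ τ : Signature G, σ.SwitchingEquivalent τ ∧ ∃ (x y : V) (l i : ℕ),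
    1 ≤ l ∧ 1 ≤ i ∧ IsBowtie τ x y l 1 (2 * i + 1) (-1) (2 * i + 1) 1}

/-- The signatures `σ` of `G` for which `(G, σ)` lies in `𝔅 = 𝔅_θ ∪ 𝔅_∞ ∪ 𝔅_⋈`. -/
def family (G : SimpleGraph V) : Set (Signature G) :=
  familyTheta G ∪ familyInfty G ∪ familyBowtie G

end SignedBicyclic

/-! The proof runs through family ⇒ sign-symmetric ⇒ spectrally symmetric ⇒ family.

Family ⇒ sign-symmetric: the two equal paths or cycles can be exchanged by an involutive
automorphism `φ`. It takes `σ` to a switching of `-σ` exactly when the signature `e ↦ -σ(e)σ(φ e)`,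
called `twist`, can be switched to all-positive. On each of the three shapes this is decided by a
few walk signs (the `exists_potential` lemmas), and the parity and sign conditions defining the
family make these signs trivial.

Sign-symmetric ⇒ spectrally symmetric: an automorphism followed by switching conjugates the
adjacency matrix `A` to `-A` by a signed permutation matrix.

Spectrally symmetric ⇒ family: the trace of `A ^ n`, the signed count of closed walks of length `n`,
vanishes for odd `n`. Take `n` to be the least odd length of a closed walk, which exists since `G`
is not bipartite. All closed walks of length `n` are cycles (`isCycle_of_odd_of_minimal`), and both
signs must occur among them. This gives two distinct cycles of equal odd length and opposite sign.
By minimality they determine `G`, together with a connecting path if they are disjoint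
(`IsBaseBicyclic.exists_shape`). Equal lengths and opposite signs then place `σ` in the family. -/

namespace SignedBicyclic

universe u

section

variable {V : Type u}

/-! ### Signs of walks under switching -/

namespace Signature

variable {G : SimpleGraph V}

/-- The sign of an edge, extended by `1` to all unordered pairs. -/
noncomputable def sgn (σ : Signature G) (e : Sym2 V) : ℤˣ := by
  classical
  exact if h : e ∈ G.edgeSet then σ ⟨e, h⟩ else 1

lemma sgn_of_mem (σ : Signature G) {e : Sym2 V} (h : e ∈ G.edgeSet) : σ.sgn e = σ ⟨e, h⟩ := by
  simp [sgn, h]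

/-- The sign of a walk: the product of the signs of its edges. -/
noncomputable def walkSign (σ : Signature G) {x y : V} (w : G.Walk x y) : ℤˣ :=
  (w.edges.map σ.sgn).prod

@[simp] lemma walkSign_nil (σ : Signature G) (x : V) :
    σ.walkSign (SimpleGraph.Walk.nil : G.Walk x x) = 1 := by
  simp [walkSign]

@[simp] lemma walkSign_cons (σ : Signature G) {x y z : V} (h : G.Adj x y) (w : G.Walk y z) :
    σ.walkSign (.cons h w) = σ.sgn s(x, y) * σ.walkSign w := by
  simp [walkSign]

@[simp] lemma walkSign_append (σ : Signature G) {x y z : V} (v : G.Walk x y) (w : G.Walk y z) :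
    σ.walkSign (v.append w) = σ.walkSign v * σ.walkSign w := by
  simp [walkSign]

@[simp] lemma walkSign_reverse (σ : Signature G) {x y : V} (w : G.Walk x y) :
    σ.walkSign w.reverse = σ.walkSign w := by
  simp [walkSign, List.map_reverse, List.prod_reverse]

lemma walkSign_eq_of_perm (σ : Signature G) {x y x' y' : V} {v : G.Walk x y} {w : G.Walk x' y'}
    (h : v.edges.Perm w.edges) : σ.walkSign v = σ.walkSign w :=
  (h.map _).prod_eq

/-- Switching with respect to the set on which a `±1`-valued function is `-1`. -/
noncomputable def switchBy (σ : Signature G) (f : V → ℤˣ) : Signature G :=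
  σ.switch {v | f v = -1}

lemma sgn_switchBy (σ : Signature G) (f : V → ℤˣ) {x y : V} (h : G.Adj x y) :
    (σ.switchBy f).sgn s(x, y) = f x * f y * σ.sgn s(x, y) := by
  rw [sgn_of_mem _ (show s(x, y) ∈ G.edgeSet from h), sgn_of_mem _ (show s(x, y) ∈ G.edgeSet from h)]
  rcases Int.units_eq_one_or (f x) with hx | hx <;> rcases Int.units_eq_one_or (f y) with hy | hy <;>
    simp [switchBy, switch, hx, hy]

lemma exists_switch_eq_switchBy (σ : Signature G) (U : Set V) :
    ∃ f : V → ℤˣ, σ.switch U = σ.switchBy f := by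
  classical
  refine ⟨fun v => if v ∈ U then -1 else 1, ?_⟩
  rw [switchBy]
  congr 1
  ext v
  by_cases h : v ∈ U <;> simp [h]

/-- The inner factors telescope. In particular the sign of a closed walk is a switching invariant.
-/
lemma walkSign_switchBy (σ : Signature G) (f : V → ℤˣ) {x y : V} (w : G.Walk x y) :
    (σ.switchBy f).walkSign w = f x * f y * σ.walkSign w := by
  induction w with
  | nil => simp
  | @cons a b c h w ih =>
    rw [walkSign_cons, walkSign_cons, ih, sgn_switchBy σ f h]
    calc f a * f b * σ.sgn s(a, b) * (f b * f c * σ.walkSign w)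
        = (f b * f b) * (f a * f c * (σ.sgn s(a, b) * σ.walkSign w)) := by
          simp only [mul_assoc, mul_left_comm]
      _ = _ := by rw [Int.units_mul_self, one_mul]

lemma hasMark_iff (σ : Signature G) {x y : V} (w : G.Walk x y) (a : ℤˣ) :
    σ.HasMark w a ↔ {e | e ∈ w.edges ∧ σ.sgn e = -1}.ncard = if a = 1 then 0 else 1 := by
  have : {e | e ∈ w.edges ∧ e ∈ σ.negEdges} = {e | e ∈ w.edges ∧ σ.sgn e = -1} := by
    ext e
    refine and_congr_right fun he => ?_
    have := w.edges_subset_edgeSet he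
    simp [negEdges, sgn_of_mem _ this, this]
  rw [HasMark, this]

lemma hasMark_congr {σ τ : Signature G} {x y : V} {w : G.Walk x y} {a : ℤˣ}
    (h : ∀ e ∈ w.edges, σ.sgn e = τ.sgn e) (hw : σ.HasMark w a) : τ.HasMark w a := by
  rw [hasMark_iff] at hw ⊢
  rw [← hw]
  congr 1
  ext e
  exact and_congr_right fun he => by rw [h e he]

/-- Potentials are built one path or cycle at a time; this shows that a later adjustment off the
support of `w` does not spoil its mark. -/
lemma hasMark_switchBy_congr {σ : Signature G} {f g : V → ℤˣ} {x y : V} {w : G.Walk x y} {a : ℤˣ}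
    (h : ∀ v ∈ w.support, f v = g v) (hw : (σ.switchBy f).HasMark w a) :
    (σ.switchBy g).HasMark w a := by
  refine hasMark_congr (fun e he => ?_) hw
  induction e with
  | _ u v =>
    have hadj := w.adj_of_mem_edges he
    rw [sgn_switchBy _ _ hadj, sgn_switchBy _ _ hadj, h u (w.fst_mem_support_of_mem_edges he),
      h v (w.snd_mem_support_of_mem_edges he)]

lemma sgn_eq_one_of_hasMark_one {σ : Signature G} {x y : V} {w : G.Walk x y}
    (h : σ.HasMark w 1) : ∀ e ∈ w.edges, σ.sgn e = 1 := by
  intro e he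
  rw [hasMark_iff, if_pos rfl, Set.ncard_eq_zero
    ((List.finite_toSet w.edges).subset fun _ h => h.1)] at h
  refine (Int.units_eq_one_or _).resolve_right fun h' => ?_
  have : e ∈ {e | e ∈ w.edges ∧ σ.sgn e = -1} := ⟨he, h'⟩
  rw [h] at this
  exact this

/-- The mark counts a set of edges while the sign is a product over a list, so edges must not
repeat. -/
lemma walkSign_eq_of_hasMark {σ : Signature G} {x y : V} {w : G.Walk x y} (hw : w.edges.Nodup)
    {a : ℤˣ} (h : σ.HasMark w a) : σ.walkSign w = a := by
  classical
  have key : σ.walkSign w = (-1) ^ {e | e ∈ w.edges ∧ σ.sgn e = -1}.ncard := by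
    have h1 : {e | e ∈ w.edges ∧ σ.sgn e = -1} =
        ((w.edges.toFinset.filter fun e => σ.sgn e = -1 : Finset (Sym2 V)) : Set (Sym2 V)) := by
      ext e; simp
    rw [h1, Set.ncard_coe_finset, ← Finset.prod_const, Finset.prod_filter, walkSign,
      ← List.prod_toFinset _ hw]
    refine Finset.prod_congr rfl fun e _ => ?_
    rcases Int.units_eq_one_or (σ.sgn e) with h | h <;> simp [h]
  rw [hasMark_iff] at h
  rw [key, h]
  rcases Int.units_eq_one_or a with rfl | rfl <;> simp

/-- A potential can be changed at the inner vertices of a path or cycle so that after switching at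
most one edge is negative. -/
lemma exists_potential (σ : Signature G) {a b : V} (w : G.Walk a b) (hw : w.support.tail.Nodup)
    (ha : a ∈ w.support.tail → a = b) (f : V → ℤˣ) :
    ∃ g : V → ℤˣ, (∀ v, (v ∈ w.support → v = a ∨ v = b) → g v = f v) ∧
      (σ.switchBy g).HasMark w (f a * f b * σ.walkSign w) := by
  classical
  induction w generalizing f with
  | nil => exact ⟨f, fun _ _ => rfl, by simp [hasMark_iff]⟩
  | @cons a z b h w ih =>
    simp only [SimpleGraph.Walk.support_cons, List.tail_cons] at hw ha
    cases w with
    -- Here only the last edge remains; it absorbs the whole sign and carries the mark.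
    | nil =>
      refine ⟨f, fun _ _ => rfl, ?_⟩
      rw [hasMark_iff, walkSign_cons, walkSign_nil, mul_one, ← sgn_switchBy σ f h]
      rcases Int.units_eq_one_or ((σ.switchBy f).sgn s(a, z)) with h1 | h1
      · rw [h1, if_pos rfl, Set.ncard_eq_zero
          ((List.finite_toSet _).subset fun _ h => h.1)]
        ext e
        simp only [SimpleGraph.Walk.edges_cons, SimpleGraph.Walk.edges_nil, List.mem_singleton,
          Set.mem_ofPred_eq, Set.mem_empty_iff_false, iff_false, not_and]
        rintro rfl
        simp [h1]
      · rw [h1, if_neg (by decide), Set.ncard_eq_one]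
        refine ⟨s(a, z), ?_⟩
        ext e
        simp only [SimpleGraph.Walk.edges_cons, SimpleGraph.Walk.edges_nil, List.mem_singleton,
          Set.mem_ofPred_eq, Set.mem_singleton_iff, and_iff_left_iff_imp]
        rintro rfl
        exact h1
    | @cons _ z' _ h' w' =>
      set w := SimpleGraph.Walk.cons h' w' with hwdef
      have hzb : z ≠ b := by
        rintro rfl
        rw [hwdef, SimpleGraph.Walk.support_cons, List.nodup_cons] at hw
        exact hw.1 w'.end_mem_support
      have hzt : z ∉ w.support.tail := by
        rw [hwdef, SimpleGraph.Walk.support_cons, List.nodup_cons] at hw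
        exact hw.1
      -- The value at `z` is chosen to make the first edge positive, pushing its sign further along
      -- the walk.
      obtain ⟨g, hg, hm⟩ := ih hw.tail (fun h => absurd h hzt)
        (Function.update f z (f a * σ.sgn s(a, z)))
      -- If `a` recurs it is the end `b`, whose value the induction hypothesis preserves.
      have hga : g a = f a := by
        rw [hg a fun h => Or.inr (ha h), Function.update_of_ne h.ne]
      have hgz : g z = f a * σ.sgn s(a, z) := by
        rw [hg z fun _ => Or.inl rfl, Function.update_self]
      have hsgn : (σ.switchBy g).sgn s(a, z) = 1 := by
        rw [sgn_switchBy _ _ h, hga, hgz, ← mul_assoc, Int.units_mul_self, one_mul,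
          Int.units_mul_self]
      refine ⟨g, fun v hv => ?_, ?_⟩
      · by_cases hva : v = a
        · rw [hva, hga]
        · have hvz : v ≠ z := by
            rintro rfl
            rcases hv (by simp [hwdef]) with h1 | h1
            exacts [hva h1, hzb h1]
          rw [hg v fun h1 => Or.inr ((hv (by simp [h1])).resolve_left hva),
            Function.update_of_ne hvz]
      · rw [hasMark_iff] at hm ⊢
        rw [Function.update_self, Function.update_of_ne hzb.symm] at hm
        rw [walkSign_cons]
        have h1 : f a * σ.sgn s(a, z) * f b * σ.walkSign w =
            f a * f b * (σ.sgn s(a, z) * σ.walkSign w) := by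
          simp only [mul_assoc, mul_left_comm]
        rw [← h1, ← hm]
        congr 1
        ext e
        simp only [SimpleGraph.Walk.edges_cons, List.mem_cons, Set.mem_ofPred_eq]
        refine ⟨fun ⟨h1, h2⟩ => ⟨h1.resolve_left ?_, h2⟩, fun ⟨h1, h2⟩ => ⟨Or.inr h1, h2⟩⟩
        rintro rfl
        rw [hsgn] at h2
        exact absurd h2 (by decide)

/-! ### Spectrum -/

lemma adjMatrix_apply (σ : Signature G) {x y : V} (h : G.Adj x y) :
    σ.adjMatrix x y = ((σ.sgn s(x, y) : ℤ) : ℝ) := by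
  rw [sgn_of_mem _ (show s(x, y) ∈ G.edgeSet from h)]
  simp [adjMatrix, h]

lemma adjMatrix_apply_of_not_adj (σ : Signature G) {x y : V} (h : ¬ G.Adj x y) :
    σ.adjMatrix x y = 0 := by
  simp [adjMatrix, h]

lemma isHermitian_adjMatrix (σ : Signature G) : σ.adjMatrix.IsHermitian := by
  ext x y
  rw [Matrix.conjTranspose_apply, star_trivial]
  by_cases h : G.Adj x y
  · rw [adjMatrix_apply σ h, adjMatrix_apply σ h.symm, Sym2.eq_swap]
  · rw [adjMatrix_apply_of_not_adj σ h, adjMatrix_apply_of_not_adj σ fun h' => h h'.symm]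

variable [Fintype V]

-- The signed form of counting walks by powers of the adjacency matrix, by splitting off the first
-- edge.
open Classical in
lemma adjMatrix_pow_apply (σ : Signature G) (n : ℕ) (x y : V) :
    (σ.adjMatrix ^ n) x y =
      ∑ w ∈ G.finsetWalkLength n x y, ((σ.walkSign w : ℤ) : ℝ) := by
  induction n generalizing x y with
  | zero => obtain rfl | h := eq_or_ne x y <;> simp [SimpleGraph.finsetWalkLength, *]
  | succ n ih =>
    rw [pow_succ', Matrix.mul_apply, SimpleGraph.finsetWalkLength, Finset.sum_biUnion]
    · rw [← Finset.sum_subset (Finset.subset_univ (G.neighborFinset x))]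
      · rw [Finset.sum_subtype (G.neighborFinset x) (p := fun z => z ∈ G.neighborSet x)
          (fun z => by simp)]
        refine Fintype.sum_congr _ _ fun z => ?_
        have hz : G.Adj x z := z.2
        rw [ih, adjMatrix_apply σ hz, Finset.mul_sum, Finset.sum_map]
        refine Finset.sum_congr rfl fun w _ => ?_
        change _ = (((σ.walkSign (.cons hz w) : ℤˣ) : ℤ) : ℝ)
        rw [walkSign_cons]
        push_cast
        rfl
      · intro z _ hz
        rw [adjMatrix_apply_of_not_adj, zero_mul]
        simpa using hz
    · rintro ⟨z, hz⟩ - ⟨t, ht⟩ - hzt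
      rw [Function.onFun, Finset.disjoint_left]
      rintro p hp hp'
      simp only [Finset.mem_map] at hp hp'
      obtain ⟨v, -, rfl⟩ := hp
      obtain ⟨v', -, h⟩ := hp'
      cases h
      exact hzt rfl

open Matrix in
lemma _root_.SignedBicyclic.trace_pow_eq_sum_roots [DecidableEq V] {A : Matrix V V ℝ}
    (hA : A.IsHermitian) (n : ℕ) :
    (A ^ n).trace = (A.charpoly.roots.map (· ^ n)).sum := by
  rw [hA.roots_charpoly_eq_eigenvalues]
  conv_lhs => rw [hA.spectral_theorem, ← map_pow, Unitary.conjStarAlgAut_apply, trace_mul_comm,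
    ← mul_assoc]
  simp [Matrix.diagonal_pow, Matrix.trace_diagonal]

open Matrix in
lemma _root_.SignedBicyclic.roots_charpoly_neg [DecidableEq V] {A : Matrix V V ℝ}
    (hA : A.IsHermitian) : (-A).charpoly.roots = A.charpoly.roots.map (- ·) := by
  have h : (-A).charpoly = ∏ i, (Polynomial.X - Polynomial.C (-hA.eigenvalues i)) := by
    conv_lhs => rw [hA.spectral_theorem, ← map_neg, Unitary.conjStarAlgAut_apply,
      charpoly_mul_comm, ← mul_assoc]
    rw [Unitary.coe_star_mul_self, one_mul, diagonal_neg, charpoly_diagonal]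
    rfl
  rw [h, hA.roots_charpoly_eq_eigenvalues, Polynomial.roots_prod]
  · simp
  · simp only [ne_eq, Finset.prod_eq_zero_iff, Finset.mem_univ, true_and, not_exists]
    exact fun i => Polynomial.X_sub_C_ne_zero _

/-- The definition tests eigenvalues only. If `x` is not one, neither is `-x`, since symmetry at
`-x` would make `x` an eigenvalue. -/
lemma isSpectrallySymmetric_iff (σ : Signature G) :
    σ.IsSpectrallySymmetric ↔ σ.spectrum.map (- ·) = σ.spectrum := by
  have hcount : ∀ x, (σ.spectrum.map (- ·)).count x = σ.spectrum.count (-x) := by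
    intro x
    conv_lhs => rw [← neg_neg x]
    exact Multiset.count_map_eq_count' _ _ neg_injective _
  constructor
  · intro h
    ext x
    rw [hcount]
    by_cases hx : x ∈ σ.spectrum
    · exact (h x hx).2
    · rw [Multiset.count_eq_zero_of_notMem hx, Multiset.count_eq_zero]
      intro h'
      exact hx (by simpa using (h _ h').1)
  · intro h x hx
    have : σ.spectrum.count (-x) = σ.spectrum.count x := by rw [← hcount, h]
    refine ⟨?_, this⟩
    rw [← Multiset.count_pos, this]
    exact Multiset.count_pos.2 hx

/-- The trace is a power sum of the eigenvalues, and for odd `n` negating them all negates it. -/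
lemma trace_adjMatrix_pow_eq_zero [DecidableEq V] {σ : Signature G} (h : σ.IsSpectrallySymmetric)
    {n : ℕ} (hn : Odd n) : (σ.adjMatrix ^ n).trace = 0 := by
  -- The two sides differ only in the instance of decidable equality on `V`.
  have h0 : σ.spectrum = σ.adjMatrix.charpoly.roots := by
    rw [spectrum]
    congr!
  rw [trace_pow_eq_sum_roots σ.isHermitian_adjMatrix, ← h0]
  have h1 := congrArg (fun s : Multiset ℝ => (s.map (· ^ n)).sum) (σ.isSpectrallySymmetric_iff.1 h)
  simp only [Multiset.map_map, Function.comp_def, hn.neg_pow] at h1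
  rw [Multiset.sum_map_neg] at h1
  linarith

/-- In a spectrally symmetric signed graph, closed walks of odd length do not all have the same
sign. -/
lemma exists_closed_walk_of_isSpectrallySymmetric {σ : Signature G} (h : σ.IsSpectrallySymmetric)
    {x : V} {w : G.Walk x x} (hw : Odd w.length) (a : ℤˣ) :
    ∃ (y : V) (v : G.Walk y y), v.length = w.length ∧ σ.walkSign v = a := by
  classical
  by_contra! hcon
  have hsgn : ∀ (y : V) (v : G.Walk y y), v.length = w.length → σ.walkSign v = -a :=
    fun y v hv => Int.units_ne_iff_eq_neg.1 (hcon y v hv)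
  have htr := trace_adjMatrix_pow_eq_zero h hw
  -- With all signs equal to `-a` nothing cancels: the trace is `-a` times the number of closed
  -- walks, which is nonzero because of `w`.
  have hdiag : ∀ y, (σ.adjMatrix ^ w.length) y y =
      (((-a : ℤˣ) : ℤ) : ℝ) * (G.finsetWalkLength w.length y y).card := by
    intro y
    rw [adjMatrix_pow_apply, Finset.sum_congr rfl fun v hv => by
      rw [hsgn y v (SimpleGraph.mem_finsetWalkLength_iff.1 hv)], Finset.sum_const, nsmul_eq_mul,
      mul_comm]
  rw [Matrix.trace, Finset.sum_congr rfl fun y _ => (Matrix.diag_apply _ y).trans (hdiag y),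
    ← Finset.mul_sum, mul_eq_zero] at htr
  rcases htr with h1 | h1
  · norm_cast at h1
    exact (-a).ne_zero h1
  · norm_cast at h1
    rw [Finset.sum_eq_zero_iff] at h1
    have := h1 x (Finset.mem_univ x)
    rw [Finset.card_eq_zero] at this
    exact Finset.notMem_empty w (this ▸ SimpleGraph.mem_finsetWalkLength_iff.2 rfl)

/-- A sign-symmetric signed graph is cospectral with its negation. -/
lemma isSpectrallySymmetric_of_isSignSymmetric {σ : Signature G} (h : σ.IsSignSymmetric) :
    σ.IsSpectrallySymmetric := by
  classical
  obtain ⟨U, φ, hφ⟩ := h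
  obtain ⟨f, hf⟩ := σ.negation.exists_switch_eq_switchBy U
  rw [hf] at hφ
  -- Entrywise form of the conjugation of `A` to `-A` by the permutation `φ` and the diagonal matrix
  -- of switching signs.
  have hentry : ∀ x y, σ.adjMatrix x y =
      -(((f (φ x) : ℤ) : ℝ) * σ.adjMatrix (φ x) (φ y) * ((f (φ y) : ℤ) : ℝ)) := by
    intro x y
    by_cases hxy : G.Adj x y
    · have hxy' : G.Adj (φ x) (φ y) := φ.map_adj_iff.2 hxy
      have h1 := hφ ⟨s(x, y), hxy⟩
      rw [← sgn_of_mem σ (show s(x, y) ∈ G.edgeSet from hxy)] at h1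
      have h2 : (σ.negation.switchBy f) (φ.mapEdgeSet ⟨s(x, y), hxy⟩) =
          (σ.negation.switchBy f).sgn s(φ x, φ y) := by
        rw [sgn_of_mem _ (show s(φ x, φ y) ∈ G.edgeSet from hxy')]
        rfl
      have h3 : σ.negation.sgn s(φ x, φ y) = - σ.sgn s(φ x, φ y) := by
        rw [sgn_of_mem _ (show s(φ x, φ y) ∈ G.edgeSet from hxy'),
          sgn_of_mem _ (show s(φ x, φ y) ∈ G.edgeSet from hxy')]
        rfl
      rw [h2, sgn_switchBy _ _ hxy', h3] at h1
      rw [adjMatrix_apply σ hxy, adjMatrix_apply σ hxy', ← h1]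
      push_cast
      ring
    · rw [adjMatrix_apply_of_not_adj σ hxy,
        adjMatrix_apply_of_not_adj σ fun h => hxy (φ.map_adj_iff.1 h)]
      simp
  have hf2 : ∀ v, ((f v : ℤ) : ℝ) * ((f v : ℤ) : ℝ) = 1 := by
    intro v
    rcases Int.units_eq_one_or (f v) with h | h <;> simp [h]
  set D : Matrix V V ℝ := Matrix.diagonal fun v => ((f v : ℤ) : ℝ) with hD
  have hDD : D * D = 1 := by
    rw [hD, Matrix.diagonal_mul_diagonal]
    simp [hf2]
  have hmat : σ.adjMatrix = Matrix.reindex φ.symm.toEquiv φ.symm.toEquiv (D * -σ.adjMatrix * D) := by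
    ext x y
    rw [hentry x y]
    simp only [hD, Matrix.reindex_apply, Matrix.submatrix_apply, Matrix.mul_diagonal,
      Matrix.diagonal_mul, Matrix.neg_apply, mul_neg, neg_mul]
    rfl
  have hchar : σ.adjMatrix.charpoly = (-σ.adjMatrix).charpoly := by
    conv_lhs => rw [hmat, Matrix.charpoly_reindex, Matrix.charpoly_mul_comm, ← mul_assoc, hDD,
      one_mul]
  rw [isSpectrallySymmetric_iff]
  have h0 : σ.spectrum = σ.adjMatrix.charpoly.roots := rfl
  rw [h0, ← roots_charpoly_neg σ.isHermitian_adjMatrix, ← hchar]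

end Signature

end

section

variable {V : Type u} {G : SimpleGraph V}

/-! ### Switching the three shapes -/

lemma nodup_tail_of_isPath {x y : V} {p : G.Walk x y} (hp : p.IsPath) :
    p.support.tail.Nodup ∧ (x ∈ p.support.tail → x = y) := by
  have h := hp.support_nodup
  rw [← p.cons_tail_support, List.nodup_cons] at h
  exact ⟨h.2, fun h' => absurd h' h.1⟩

namespace Signature

lemma exists_potential_of_isPath (σ : Signature G) {x y : V} {p : G.Walk x y} (hp : p.IsPath)
    (f : V → ℤˣ) : ∃ g : V → ℤˣ, (∀ v, (v ∈ p.support → v = x ∨ v = y) → g v = f v) ∧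
      (σ.switchBy g).HasMark p (f x * f y * σ.walkSign p) :=
  σ.exists_potential p (nodup_tail_of_isPath hp).1 (nodup_tail_of_isPath hp).2 f

lemma exists_potential_of_isCycle (σ : Signature G) {x : V} {c : G.Walk x x} (hc : c.IsCycle)
    (f : V → ℤˣ) : ∃ g : V → ℤˣ, (∀ v, (v ∈ c.support → v = x) → g v = f v) ∧
      (σ.switchBy g).HasMark c (σ.walkSign c) := by
  obtain ⟨g, hg, hm⟩ := σ.exists_potential c hc.support_nodup (fun _ => rfl) f
  rw [Int.units_mul_self, one_mul] at hm
  exact ⟨g, fun v hv => hg v fun h => Or.inl (hv h), hm⟩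

end Signature

open Signature

/-- The paths are treated in turn. Each step changes the potential only at inner vertices of its own
path, which lie on no other path, so earlier marks survive. The value at `y` is set to the sign of
`p`, which makes the sign of `p` after switching positive. -/
lemma ConsistsOfTheta.exists_potential {x y : V} {p q r : G.Walk x y} (h : ConsistsOfTheta G p q r)
    (σ : Signature G) : ∃ f : V → ℤˣ, (σ.switchBy f).HasMark p 1 ∧
      (σ.switchBy f).HasMark q (σ.walkSign p * σ.walkSign q) ∧
      (σ.switchBy f).HasMark r (σ.walkSign p * σ.walkSign r) := by
  classical
  obtain ⟨f₁, h₁, m₁⟩ := σ.exists_potential_of_isPath h.isPath₁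
    (fun v => if v = y then σ.walkSign p else 1)
  have h₁x : f₁ x = 1 := by rw [h₁ x fun _ => Or.inl rfl, if_neg h.ne]
  have h₁y : f₁ y = σ.walkSign p := by rw [h₁ y fun _ => Or.inr rfl, if_pos rfl]
  rw [if_neg h.ne, if_pos rfl, one_mul, Int.units_mul_self] at m₁
  obtain ⟨f₂, h₂, m₂⟩ := σ.exists_potential_of_isPath h.isPath₂ f₁
  rw [h₁x, h₁y, one_mul] at m₂
  obtain ⟨f₃, h₃, m₃⟩ := σ.exists_potential_of_isPath h.isPath₃ f₂
  rw [h₂ x fun _ => Or.inl rfl, h₂ y fun _ => Or.inr rfl, h₁x, h₁y, one_mul] at m₃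
  refine ⟨f₃, hasMark_switchBy_congr (fun v hv => ?_) m₁,
    hasMark_switchBy_congr (fun v hv => ?_) m₂, m₃⟩
  · rw [h₃ v fun hr => h.inter₁₃ v hv hr, h₂ v fun hq => h.inter₁₂ v hv hq]
  · rw [h₃ v fun hr => h.inter₂₃ v hv hr]

lemma ConsistsOfInfty.exists_potential {x : V} {c d : G.Walk x x} (h : ConsistsOfInfty G c d)
    (σ : Signature G) : ∃ f : V → ℤˣ, (σ.switchBy f).HasMark c (σ.walkSign c) ∧
      (σ.switchBy f).HasMark d (σ.walkSign d) := by
  obtain ⟨f₁, -, m₁⟩ := σ.exists_potential_of_isCycle h.isCycle₁ 1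
  obtain ⟨f₂, h₂, m₂⟩ := σ.exists_potential_of_isCycle h.isCycle₂ f₁
  exact ⟨f₂, hasMark_switchBy_congr (fun v hv => (h₂ v fun hd => h.inter v hv hd).symm) m₁, m₂⟩

lemma ConsistsOfBowtie.exists_potential {x y : V} {p : G.Walk x y} {c : G.Walk x x}
    {d : G.Walk y y} (h : ConsistsOfBowtie G p c d) (σ : Signature G) :
    ∃ f : V → ℤˣ, (σ.switchBy f).HasMark p 1 ∧ (σ.switchBy f).HasMark c (σ.walkSign c) ∧
      (σ.switchBy f).HasMark d (σ.walkSign d) := by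
  classical
  have hxy : x ≠ y := by
    rintro rfl
    exact h.disjoint c.start_mem_support d.start_mem_support
  obtain ⟨f₁, h₁, m₁⟩ := σ.exists_potential_of_isPath h.isPath
    (fun v => if v = y then σ.walkSign p else 1)
  rw [if_neg hxy, if_pos rfl, one_mul, Int.units_mul_self] at m₁
  obtain ⟨f₂, h₂, m₂⟩ := σ.exists_potential_of_isCycle h.isCycle₁ f₁
  obtain ⟨f₃, h₃, m₃⟩ := σ.exists_potential_of_isCycle h.isCycle₂ f₂
  refine ⟨f₃, hasMark_switchBy_congr (fun v hv => ?_) m₁,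
    hasMark_switchBy_congr (fun v hv => ?_) m₂, m₃⟩
  · rw [h₃ v fun hd => h.inter₂ v hv hd, h₂ v fun hc => h.inter₁ v hv hc]
  · rw [h₃ v fun hd => absurd hd (h.disjoint hv)]

/-! ### Automorphisms that exchange walks -/

/-- The map exchanges `α i` with `β i` and fixes everything else. The first two conditions make each
direction well defined; the third reconciles them at a vertex listed by both. -/
lemma exists_involutive {ι : Type*} (α β : ι → V) (h₁ : ∀ i j, α i = α j → β i = β j)
    (h₂ : ∀ i j, β i = β j → α i = α j) (h₃ : ∀ i j, α i = β j → β i = α j) :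
    ∃ φ : V → V, Function.Involutive φ ∧ (∀ i, φ (α i) = β i) ∧ (∀ i, φ (β i) = α i) ∧
      ∀ v, (∀ i, α i ≠ v) → (∀ i, β i ≠ v) → φ v = v := by
  classical
  have key : ∀ v, ∃ w, (∀ i, α i = v → w = β i) ∧ (∀ i, β i = v → w = α i) ∧
      ((∀ i, α i ≠ v) → (∀ i, β i ≠ v) → w = v) := by
    intro v
    by_cases ha : ∃ i, α i = v
    · obtain ⟨i, rfl⟩ := ha
      exact ⟨β i, fun j hj => h₁ _ _ hj.symm, fun j hj => h₃ _ _ hj.symm, fun h => absurd rfl (h i)⟩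
    · by_cases hb : ∃ i, β i = v
      · obtain ⟨i, rfl⟩ := hb
        exact ⟨α i, fun j hj => absurd ⟨j, hj⟩ ha, fun j hj => h₂ _ _ hj.symm,
          fun _ h => absurd rfl (h i)⟩
      · exact ⟨v, fun j hj => absurd ⟨j, hj⟩ ha, fun j hj => absurd ⟨j, hj⟩ hb, fun _ _ => rfl⟩
  choose φ hα hβ hv using key
  refine ⟨φ, fun v => ?_, fun i => hα _ i rfl, fun i => hβ _ i rfl, hv⟩
  by_cases ha : ∃ i, α i = v
  · obtain ⟨i, rfl⟩ := ha
    rw [hα _ i rfl, hβ _ i rfl]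
  · by_cases hb : ∃ i, β i = v
    · obtain ⟨i, rfl⟩ := hb
      rw [hβ _ i rfl, hα _ i rfl]
    · push Not at ha hb
      rw [hv v ha hb, hv v ha hb]

/-- `φ` takes the vertices of `w` in turn to those of `w'`. -/
def Carries (φ : V → V) {x y x' y' : V} (w : G.Walk x y) (w' : G.Walk x' y') : Prop :=
  w.length = w'.length ∧ ∀ i ≤ w.length, φ (w.getVert i) = w'.getVert i

lemma Carries.adj {φ : V → V} {x y x' y' : V} {w : G.Walk x y} {w' : G.Walk x' y'}
    (h : Carries φ w w') {a b : V} (hab : s(a, b) ∈ w.edges) : G.Adj (φ a) (φ b) := by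
  rw [← SimpleGraph.Walk.adj_toSubgraph_iff_mem_edges, SimpleGraph.Walk.toSubgraph_adj_iff] at hab
  obtain ⟨i, hi, hlt⟩ := hab
  have key : G.Adj (φ (w.getVert i)) (φ (w.getVert (i + 1))) := by
    rw [h.2 i hlt.le, h.2 (i + 1) hlt]
    exact w'.adj_getVert_succ (h.1 ▸ hlt)
  rcases Sym2.eq_iff.1 hi with ⟨rfl, rfl⟩ | ⟨rfl, rfl⟩
  exacts [key, key.symm]

lemma walkSign_congr (σ : Signature G) {x y x' y' : V} {w : G.Walk x y} {w' : G.Walk x' y'}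
    (hl : w.length = w'.length) (h : ∀ i ≤ w.length, w.getVert i = w'.getVert i) :
    σ.walkSign w = σ.walkSign w' := by
  obtain rfl : x = x' := by simpa using h 0 (Nat.zero_le _)
  obtain rfl : y = y' := by
    have := h w.length le_rfl
    rwa [SimpleGraph.Walk.getVert_length, hl, SimpleGraph.Walk.getVert_length] at this
  rw [SimpleGraph.Walk.ext_getVert_le_length hl h]

lemma exists_iso_of_involutive {φ : V → V} (hφ : Function.Involutive φ)
    (hadj : ∀ x y, G.Adj x y → G.Adj (φ x) (φ y)) : ∃ ψ : G ≃g G, ∀ v, ψ v = φ v :=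
  ⟨⟨hφ.toPerm, fun {a b} => ⟨fun h => by simpa [hφ a, hφ b] using hadj _ _ h, hadj a b⟩⟩,
    fun _ => rfl⟩

namespace Signature

/-- The signature whose balance expresses that `φ` takes `σ` to a switching of `-σ`. -/
def twist (σ : Signature G) (φ : G ≃g G) : Signature G := fun e => -(σ e * σ (φ.mapEdgeSet e))

lemma sgn_twist (σ : Signature G) (φ : G ≃g G) {x y : V} (h : G.Adj x y) :
    (σ.twist φ).sgn s(x, y) = -(σ.sgn s(x, y) * σ.sgn s(φ x, φ y)) := by
  have h' : G.Adj (φ x) (φ y) := φ.map_adj_iff.2 h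
  rw [sgn_of_mem _ (show s(x, y) ∈ G.edgeSet from h),
    sgn_of_mem _ (show s(x, y) ∈ G.edgeSet from h),
    sgn_of_mem _ (show s(φ x, φ y) ∈ G.edgeSet from h')]
  rfl

/-- The negation contributes one factor `-1` per edge; this is where the parity of lengths enters.
-/
lemma walkSign_twist (σ : Signature G) (φ : G ≃g G) {x y x' y' : V} {w : G.Walk x y}
    {w' : G.Walk x' y'} (hw : Carries φ w w') :
    (σ.twist φ).walkSign w = (-1) ^ w.length * (σ.walkSign w * σ.walkSign w') := by
  have key : ∀ {x y : V} (w : G.Walk x y), (σ.twist φ).walkSign w =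
      (-1) ^ w.length * (σ.walkSign w * σ.walkSign (w.map φ.toHom)) := by
    intro x y w
    induction w with
    | nil => simp
    | @cons a b c h w ih =>
      rw [walkSign_cons, walkSign_cons, SimpleGraph.Walk.map_cons, walkSign_cons, ih,
        sgn_twist σ φ h, SimpleGraph.Walk.length_cons, pow_succ]
      change -(σ.sgn s(a, b) * σ.sgn s(φ a, φ b)) * _ = _ * (_ * (σ.sgn s(φ a, φ b) * _))
      simp only [mul_neg, mul_one, neg_mul, mul_assoc, mul_left_comm]
  rw [key, walkSign_congr σ (w := w.map φ.toHom) (w' := w') (by simpa using hw.1)]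
  intro i hi
  rw [SimpleGraph.Walk.getVert_map]
  exact hw.2 i (by simpa using hi)

lemma isSignSymmetric_of_twist {σ : Signature G} (φ : G ≃g G) (g : V → ℤˣ)
    (h : ∀ e ∈ G.edgeSet, ((σ.twist φ).switchBy g).sgn e = 1) : σ.IsSignSymmetric := by
  -- Switching takes place on the image side of `φ`, so the potential is transported by `φ.symm`.
  refine ⟨{v | g (φ.symm v) = -1}, φ, ?_⟩
  rintro ⟨e, he⟩
  induction e with
  | _ x y =>
    have hxy : G.Adj x y := he
    have hxy' : G.Adj (φ x) (φ y) := φ.map_adj_iff.2 hxy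
    have h1 := h _ he
    rw [sgn_switchBy _ _ hxy, sgn_twist _ _ hxy] at h1
    have h2 : (σ.negation.switch {v | g (φ.symm v) = -1}) (φ.mapEdgeSet ⟨s(x, y), he⟩) =
        (σ.negation.switchBy fun v => g (φ.symm v)).sgn s(φ x, φ y) := by
      rw [sgn_of_mem _ (show s(φ x, φ y) ∈ G.edgeSet from hxy')]
      rfl
    have h3 : σ.negation.sgn s(φ x, φ y) = - σ.sgn s(φ x, φ y) := by
      rw [sgn_of_mem _ (show s(φ x, φ y) ∈ G.edgeSet from hxy'),
        sgn_of_mem _ (show s(φ x, φ y) ∈ G.edgeSet from hxy')]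
      rfl
    rw [h2, sgn_switchBy _ _ hxy', h3, ← sgn_of_mem σ he]
    simp only [RelIso.symm_apply_apply]
    rcases Int.units_eq_one_or (σ.sgn s(x, y)) with h4 | h4 <;> rw [h4] at h1 ⊢ <;>
      simpa using h1

end Signature

lemma getVert_eq_of_isCycle {x : V} {c : G.Walk x x} (hc : c.IsCycle) {i j : ℕ}
    (hi : i ≤ c.length) (hj : j ≤ c.length) (h : c.getVert i = c.getVert j) :
    i = j ∨ (i = 0 ∧ j = c.length) ∨ (i = c.length ∧ j = 0) := by
  have h3 := hc.three_le_length
  by_cases hi0 : i = 0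
  · by_cases hj0 : j ≤ c.length - 1
    · exact Or.inl (hc.getVert_injOn' (by simp [hi0]) hj0 h)
    · exact Or.inr (Or.inl ⟨hi0, by omega⟩)
  · by_cases hj0 : j = 0
    · by_cases hi' : i ≤ c.length - 1
      · exact Or.inl (hc.getVert_injOn' hi' (by simp [hj0]) h)
      · exact Or.inr (Or.inr ⟨by omega, hj0⟩)
    · exact Or.inl (hc.getVert_injOn (by simp; omega) (by simp; omega) h)

/-- Which positions of a cycle coincide depends only on its length, so cycles of equal length can be
matched position by position. -/
lemma getVert_eq_of_isCycle_of_isCycle {x y : V} {c : G.Walk x x} {d : G.Walk y y}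
    (hc : c.IsCycle) (hl : c.length = d.length) {i j : ℕ}
    (hi : i ≤ c.length) (hj : j ≤ c.length) (h : c.getVert i = c.getVert j) :
    d.getVert i = d.getVert j := by
  rcases getVert_eq_of_isCycle hc hi hj h with rfl | ⟨rfl, rfl⟩ | ⟨rfl, rfl⟩
  · rfl
  · rw [hl]; simp
  · rw [hl]; simp

lemma getVert_eq_start_of_isCycle {x y : V} {c : G.Walk x x} {d : G.Walk y y}
    (hc : c.IsCycle) (hl : c.length = d.length) {i : ℕ} (hi : i ≤ c.length)
    (h : c.getVert i = x) : d.getVert i = y := by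
  have := getVert_eq_of_isCycle_of_isCycle hc hl hi (Nat.zero_le _) (by rw [h]; simp)
  rw [this]; simp

variable {σ : Signature G}

/-- Exchange the two cycles. Each has twisted sign `(-1) ^ odd * (-1) = 1`, so the twist switches to
all-positive. -/
lemma ConsistsOfInfty.isSignSymmetric {x : V} {c d : G.Walk x x} (h : ConsistsOfInfty G c d)
    (hl : c.length = d.length) (hodd : Odd c.length) (hs : σ.walkSign c * σ.walkSign d = -1) :
    σ.IsSignSymmetric := by
  obtain ⟨φ, hφ, hc, hd, -⟩ := exists_involutive (ι := {i // i ≤ c.length})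
    (fun i => c.getVert i) (fun i => d.getVert i)
    (fun i j hij => getVert_eq_of_isCycle_of_isCycle h.isCycle₁ hl i.2 j.2 hij)
    (fun i j hij => getVert_eq_of_isCycle_of_isCycle h.isCycle₂ hl.symm (hl ▸ i.2) (hl ▸ j.2) hij)
    (fun i j hij => by
      have hx : c.getVert i = x :=
        h.inter _ (c.getVert_mem_support i) (hij ▸ d.getVert_mem_support j)
      rw [getVert_eq_start_of_isCycle h.isCycle₁ hl i.2 hx,
        getVert_eq_start_of_isCycle h.isCycle₂ hl.symm (hl ▸ j.2) (hij ▸ hx)])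
  have hcd : Carries φ c d := ⟨hl, fun i hi => hc ⟨i, hi⟩⟩
  have hdc : Carries φ d c := ⟨hl.symm, fun i hi => hd ⟨i, hl ▸ hi⟩⟩
  obtain ⟨ψ, hψ⟩ := exists_iso_of_involutive hφ fun a b hab => by
    rcases h.edge s(a, b) hab with he | he
    exacts [hcd.adj he, hdc.adj he]
  obtain rfl : φ = ψ := funext fun v => (hψ v).symm
  obtain ⟨f, mc, md⟩ := h.exists_potential (σ.twist ψ)
  rw [walkSign_twist σ ψ hcd, hs, hodd.neg_one_pow, neg_mul_neg, one_mul] at mc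
  rw [walkSign_twist σ ψ hdc, mul_comm (σ.walkSign d), hs, ← hl, hodd.neg_one_pow, neg_mul_neg,
    one_mul] at md
  refine isSignSymmetric_of_twist ψ f fun e he => ?_
  rcases h.edge e he with h1 | h1
  exacts [sgn_eq_one_of_hasMark_one mc e h1, sgn_eq_one_of_hasMark_one md e h1]

/-- Exchange `q` with `r` and fix `p`. The cycles formed by `p` with `q` and with `r` have odd
length, and the factor `-1` from `hs` makes their twisted signs positive. -/
lemma ConsistsOfTheta.isSignSymmetric {x y : V} {p q r : G.Walk x y} (h : ConsistsOfTheta G p q r)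
    (hl : q.length = r.length) (hodd : Odd (p.length + q.length))
    (hs : σ.walkSign q * σ.walkSign r = -1) : σ.IsSignSymmetric := by
  have hends : ∀ {s t : G.Walk x y}, s.IsPath → s.length = t.length → ∀ {i}, i ≤ s.length →
      s.getVert i = x ∨ s.getVert i = y → t.getVert i = s.getVert i := by
    intro s t hs hst i hi h
    rcases h with h | h
    · obtain rfl := (hs.getVert_eq_start_iff hi).1 h
      simp
    · obtain rfl := (hs.getVert_eq_end_iff hi).1 h
      rw [SimpleGraph.Walk.getVert_length, hst, SimpleGraph.Walk.getVert_length]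
  obtain ⟨φ, hφ, hq, hr, hfix⟩ := exists_involutive (ι := {i // i ≤ q.length})
    (fun i => q.getVert i) (fun i => r.getVert i)
    (fun i j hij => by rw [h.isPath₂.getVert_injOn i.2 j.2 hij])
    (fun i j hij => by
      rw [h.isPath₃.getVert_injOn (show i.1 ≤ _ from hl ▸ i.2) (show j.1 ≤ _ from hl ▸ j.2) hij])
    (fun i j hij => by
      have hx := h.inter₂₃ _ (q.getVert_mem_support i) (hij ▸ r.getVert_mem_support j)
      have h1 := hends h.isPath₂ hl i.2 hx
      have h2 := hends h.isPath₃ hl.symm (hl ▸ j.2 : j.1 ≤ r.length) (by rwa [← hij])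
      exact h1.trans (hij.trans h2.symm))
  have hqr : Carries φ q r := ⟨hl, fun i hi => hq ⟨i, hi⟩⟩
  have hrq : Carries φ r q := ⟨hl.symm, fun i hi => hr ⟨i, hl ▸ hi⟩⟩
  have hx : φ x = x := by simpa using hqr.2 0 (Nat.zero_le _)
  have hy : φ y = y := by
    have := hqr.2 q.length le_rfl
    rwa [SimpleGraph.Walk.getVert_length, hl, SimpleGraph.Walk.getVert_length] at this
  have hpp : Carries φ p p := by
    refine ⟨rfl, fun i hi => ?_⟩
    by_cases hxy : p.getVert i = x ∨ p.getVert i = y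
    · rcases hxy with h' | h' <;> rw [h', ‹φ _ = _›]
    · refine hfix _ (fun j hj => hxy ?_) (fun j hj => hxy ?_)
      · exact h.inter₁₂ _ (p.getVert_mem_support i) (hj ▸ q.getVert_mem_support j)
      · exact h.inter₁₃ _ (p.getVert_mem_support i) (hj ▸ r.getVert_mem_support j)
  obtain ⟨ψ, hψ⟩ := exists_iso_of_involutive hφ fun a b hab => by
    rcases h.edge s(a, b) hab with he | he | he
    exacts [hpp.adj he, hqr.adj he, hrq.adj he]
  obtain rfl : φ = ψ := funext fun v => (hψ v).symm
  obtain ⟨f, mp, mq, mr⟩ := h.exists_potential (σ.twist ψ)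
  have h1 : (σ.twist ψ).walkSign p * (σ.twist ψ).walkSign q = 1 := by
    rw [walkSign_twist σ ψ hpp, walkSign_twist σ ψ hqr, hs, Int.units_mul_self, mul_one,
      ← mul_assoc, ← pow_add, hodd.neg_one_pow, neg_mul_neg, one_mul]
  have h2 : (σ.twist ψ).walkSign p * (σ.twist ψ).walkSign r = 1 := by
    rw [walkSign_twist σ ψ hpp, walkSign_twist σ ψ hrq, mul_comm (σ.walkSign r), hs,
      Int.units_mul_self, mul_one, ← mul_assoc, ← pow_add, ← hl, hodd.neg_one_pow, neg_mul_neg,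
      one_mul]
  rw [h1] at mq
  rw [h2] at mr
  refine isSignSymmetric_of_twist ψ f fun e he => ?_
  rcases h.edge e he with h1 | h1 | h1
  exacts [sgn_eq_one_of_hasMark_one mp e h1, sgn_eq_one_of_hasMark_one mq e h1,
    sgn_eq_one_of_hasMark_one mr e h1]

lemma ConsistsOfBowtie.isSignSymmetric {x y : V} {p : G.Walk x y} {c : G.Walk x x}
    {d : G.Walk y y} (h : ConsistsOfBowtie G p c d) (hl : c.length = d.length)
    (hodd : Odd c.length) (hs : σ.walkSign c * σ.walkSign d = -1) : σ.IsSignSymmetric := by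
  have hcp : ∀ {i j}, i ≤ c.length → j ≤ p.length → c.getVert i = p.getVert j →
      d.getVert i = y ∧ j = 0 := by
    intro i j hi hj hij
    have hx := h.inter₁ _ (p.getVert_mem_support j) (hij ▸ c.getVert_mem_support i)
    exact ⟨getVert_eq_start_of_isCycle h.isCycle₁ hl hi (hij.trans hx),
      (h.isPath.getVert_eq_start_iff hj).1 hx⟩
  have hdp : ∀ {i j}, i ≤ c.length → j ≤ p.length → d.getVert i = p.getVert j →
      c.getVert i = x ∧ j = p.length := by
    intro i j hi hj hij
    have hy := h.inter₂ _ (p.getVert_mem_support j) (hij ▸ d.getVert_mem_support i)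
    exact ⟨getVert_eq_start_of_isCycle h.isCycle₂ hl.symm (hl ▸ hi) (hij.trans hy),
      (h.isPath.getVert_eq_end_iff hj).1 hy⟩
  -- The involution exchanges the cycles and reverses the path between them, so position `i` of `p`
  -- goes to `p.length - i`.
  obtain ⟨φ, hφ, hα, hβ, -⟩ := exists_involutive
    (ι := {i // i ≤ c.length} ⊕ {i // i ≤ p.length})
    (Sum.elim (fun i => c.getVert i) (fun i => p.getVert i))
    (Sum.elim (fun i => d.getVert i) (fun i => p.getVert (p.length - i)))
    (by
      rintro (⟨i, hi⟩ | ⟨i, hi⟩) (⟨j, hj⟩ | ⟨j, hj⟩) hij <;>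
        simp only [Sum.elim_inl, Sum.elim_inr] at hij ⊢
      · exact getVert_eq_of_isCycle_of_isCycle h.isCycle₁ hl hi hj hij
      · obtain ⟨h1, rfl⟩ := hcp hi hj hij
        simp [h1]
      · obtain ⟨h1, rfl⟩ := hcp hj hi hij.symm
        simp [h1]
      · rw [h.isPath.getVert_injOn hi hj hij])
    (by
      rintro (⟨i, hi⟩ | ⟨i, hi⟩) (⟨j, hj⟩ | ⟨j, hj⟩) hij <;>
        simp only [Sum.elim_inl, Sum.elim_inr] at hij ⊢
      · exact getVert_eq_of_isCycle_of_isCycle h.isCycle₂ hl.symm (hl ▸ hi) (hl ▸ hj) hij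
      · obtain ⟨h1, h2⟩ := hdp hi (Nat.sub_le _ _) hij
        obtain rfl : j = 0 := by omega
        simp [h1]
      · obtain ⟨h1, h2⟩ := hdp hj (Nat.sub_le _ _) hij.symm
        obtain rfl : i = 0 := by omega
        simp [h1]
      · have := h.isPath.getVert_injOn (Nat.sub_le p.length i) (Nat.sub_le p.length j) hij
        obtain rfl : i = j := by omega
        rfl)
    (by
      rintro (⟨i, hi⟩ | ⟨i, hi⟩) (⟨j, hj⟩ | ⟨j, hj⟩) hij <;>
        simp only [Sum.elim_inl, Sum.elim_inr] at hij ⊢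
      · exact absurd (hij ▸ d.getVert_mem_support j) (h.disjoint (c.getVert_mem_support i))
      · obtain ⟨h1, h2⟩ := hcp hi (Nat.sub_le _ _) hij
        obtain rfl : j = p.length := by omega
        simp [h1]
      · obtain ⟨h1, rfl⟩ := hdp hj hi hij.symm
        simp [h1]
      · have := h.isPath.getVert_injOn hi (Nat.sub_le p.length j) hij
        subst this
        congr 1
        omega)
  have hcd : Carries φ c d := ⟨hl, fun i hi => hα (Sum.inl ⟨i, hi⟩)⟩
  have hdc : Carries φ d c := ⟨hl.symm, fun i hi => hβ (Sum.inl ⟨i, hl ▸ hi⟩)⟩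
  have hpp : Carries φ p p.reverse := by
    refine ⟨by simp, fun i hi => ?_⟩
    rw [SimpleGraph.Walk.getVert_reverse]
    exact hα (Sum.inr ⟨i, hi⟩)
  obtain ⟨ψ, hψ⟩ := exists_iso_of_involutive hφ fun a b hab => by
    rcases h.edge s(a, b) hab with he | he | he
    exacts [hpp.adj he, hcd.adj he, hdc.adj he]
  obtain rfl : φ = ψ := funext fun v => (hψ v).symm
  obtain ⟨f, mp, mc, md⟩ := h.exists_potential (σ.twist ψ)
  rw [walkSign_twist σ ψ hcd, hs, hodd.neg_one_pow, neg_mul_neg, one_mul] at mc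
  rw [walkSign_twist σ ψ hdc, mul_comm (σ.walkSign d), hs, ← hl, hodd.neg_one_pow, neg_mul_neg,
    one_mul] at md
  refine isSignSymmetric_of_twist ψ f fun e he => ?_
  rcases h.edge e he with h1 | h1 | h1
  exacts [sgn_eq_one_of_hasMark_one mp e h1, sgn_eq_one_of_hasMark_one mc e h1,
    sgn_eq_one_of_hasMark_one md e h1]

/-- Every member of the family is sign-symmetric. -/
lemma isSignSymmetric_of_mem_family (h : σ ∈ family G) : σ.IsSignSymmetric := by
  rcases h with (⟨τ, ⟨U, rfl⟩, x, y, l₁, l₂, -, -, hpar, p, q, r, h, rfl, rfl, hl, -, mq, mr⟩ |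
    ⟨τ, ⟨U, rfl⟩, x, i, -, c, d, h, hc, hd, mc, md⟩) |
    ⟨τ, ⟨U, rfl⟩, x, y, l, i, -, -, p, c, d, h, -, hc, hd, -, mc, md⟩ <;>
  obtain ⟨f, hf⟩ := σ.exists_switch_eq_switchBy U
  · rw [hf] at mq mr
    have hq := walkSign_eq_of_hasMark h.isPath₂.isTrail.edges_nodup mq
    have hr := walkSign_eq_of_hasMark h.isPath₃.isTrail.edges_nodup mr
    refine h.isSignSymmetric hl.symm ?_ ?_
    · rcases Nat.even_or_odd p.length with hp | hp
      · exact hp.add_odd (hpar.1 hp)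
      · refine hp.add_even (Nat.not_odd_iff_even.1 fun hq => ?_)
        exact Nat.not_even_iff_odd.2 hp (hpar.2 hq)
    -- The individual path signs change under switching, but the common factor `f x * f y` cancels
    -- in the product.
    · have : (σ.switchBy f).walkSign q * (σ.switchBy f).walkSign r = -1 := by rw [hq, hr, mul_one]
      rw [walkSign_switchBy, walkSign_switchBy] at this
      rw [← this, mul_mul_mul_comm, Int.units_mul_self, one_mul]
  · rw [hf] at mc md
    have h1 := walkSign_eq_of_hasMark h.isCycle₁.edges_nodup mc
    have h2 := walkSign_eq_of_hasMark h.isCycle₂.edges_nodup md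
    rw [walkSign_switchBy, Int.units_mul_self, one_mul] at h1 h2
    exact h.isSignSymmetric (hc.trans hd.symm) ⟨i, hc⟩ (by rw [h1, h2, mul_one])
  · rw [hf] at mc md
    have h1 := walkSign_eq_of_hasMark h.isCycle₁.edges_nodup mc
    have h2 := walkSign_eq_of_hasMark h.isCycle₂.edges_nodup md
    rw [walkSign_switchBy, Int.units_mul_self, one_mul] at h1 h2
    exact h.isSignSymmetric (hc.trans hd.symm) ⟨i, hc⟩ (by rw [h1, h2, mul_one])

end

section

variable {V : Type u} {G : SimpleGraph V}

/-! ### Walks, paths and cycles -/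

/-- A shortest closed walk of odd length is a cycle. -/
lemma isCycle_of_odd_of_minimal {x : V} {w : G.Walk x x} (hodd : Odd w.length)
    (hmin : ∀ (y : V) (v : G.Walk y y), Odd v.length → w.length ≤ v.length) : w.IsCycle := by
  cases w with
  | nil => simp at hodd
  | @cons _ z _ h p =>
    rw [SimpleGraph.Walk.length_cons] at hodd hmin
    have hp : p.IsPath := by
      rw [← SimpleGraph.Walk.IsPath.getVert_injOn_iff]
      by_contra hinj
      obtain ⟨i, j, hij, hj, heq⟩ : ∃ i j, i < j ∧ j ≤ p.length ∧ p.getVert i = p.getVert j := by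
        simp only [Set.InjOn, Set.mem_ofPred_eq, not_forall] at hinj
        obtain ⟨i, hi, j, hj, heq, hne⟩ := hinj
        rcases lt_or_gt_of_ne hne with hlt | hlt
        exacts [⟨i, j, hlt, hj, heq⟩, ⟨j, i, hlt, hi, heq.symm⟩]
      -- A repeated vertex splits the closed walk into two shorter closed walks; their lengths have
      -- odd sum, so one is odd, against minimality.
      have h1 := hmin _ (((p.drop i).take (j - i)).copy rfl
        (by rw [SimpleGraph.Walk.drop_getVert, heq]; congr 1; omega))
      have h2 := hmin _ (.cons h ((p.take i).append ((p.drop j).copy heq.symm rfl)))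
      simp only [SimpleGraph.Walk.length_copy, SimpleGraph.Walk.take_length,
        SimpleGraph.Walk.drop_length, SimpleGraph.Walk.length_cons,
        SimpleGraph.Walk.length_append] at h1 h2
      rw [Nat.odd_iff] at *
      omega
    rw [SimpleGraph.Walk.cons_isCycle_iff]
    refine ⟨hp, fun he => ?_⟩
    -- If the first edge recurs, the path `p` is that edge alone and the closed walk has even length
    -- `2`.
    have := hp.eq_adj_toWalk_of_mem_edges (Sym2.eq_swap ▸ he)
    rw [this] at hodd
    simp [SimpleGraph.Adj.toWalk] at hodd
    exact absurd hodd (by decide)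

/-- A walk into `S` splits at the first vertex in `S`. -/
lemma exists_append_of_end_mem (S : Set V) {z b : V} (w : G.Walk z b) (hb : b ∈ S) :
    ∃ y ∈ S, ∃ (v : G.Walk z y) (v' : G.Walk y b), w = v.append v' ∧
      ∀ t ∈ v.support, t ∈ S → t = y := by
  induction w with
  | nil => exact ⟨_, hb, .nil, .nil, rfl, by simp⟩
  | @cons z t b h w ih =>
    by_cases hz : z ∈ S
    · exact ⟨z, hz, .nil, .cons h w, rfl, by simp⟩
    · obtain ⟨y, hy, v, v', rfl, hv⟩ := ih hb
      refine ⟨y, hy, .cons h v, v', rfl, fun u hu huS => ?_⟩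
      rw [SimpleGraph.Walk.support_cons, List.mem_cons] at hu
      rcases hu with rfl | hu
      exacts [absurd huS hz, hv u hu huS]

/-- A walk that starts in `S` and has an edge outside `E` splits at the first such edge. -/
lemma exists_append_cons_of_notMem {S : Set V} {E : Set (Sym2 V)} (hE : ∀ e ∈ E, ∀ v ∈ e, v ∈ S)
    {a b : V} (w : G.Walk a b) (ha : a ∈ S) (hne : ∃ e ∈ w.edges, e ∉ E) :
    ∃ x ∈ S, ∃ (z : V) (h : G.Adj x z) (v : G.Walk a x) (v' : G.Walk z b),
      w = v.append (.cons h v') ∧ s(x, z) ∉ E := by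
  induction w with
  | nil => simp at hne
  | @cons a t b h w ih =>
    by_cases hat : s(a, t) ∈ E
    · obtain ⟨x, hx, z, h', v, v', rfl, hxz⟩ := ih (hE _ hat t (by simp)) (by
        obtain ⟨e, he, heE⟩ := hne
        rw [SimpleGraph.Walk.edges_cons, List.mem_cons] at he
        rcases he with rfl | he
        exacts [absurd hat heE, ⟨e, he, heE⟩])
      exact ⟨x, hx, z, h', .cons h v, v', rfl, hxz⟩
    · exact ⟨a, ha, t, h, .nil, w, rfl, hat⟩

lemma isCycle_append_comm {x y : V} {v : G.Walk x y} {w : G.Walk y x}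
    (h : (v.append w).IsCycle) : (w.append v).IsCycle := by
  rw [SimpleGraph.Walk.isCycle_def, SimpleGraph.Walk.isTrail_def,
    SimpleGraph.Walk.edges_append, SimpleGraph.Walk.tail_support_append] at h ⊢
  refine ⟨List.perm_append_comm.nodup_iff.1 h.1, fun hnil => ?_,
    List.perm_append_comm.nodup_iff.1 h.2.2⟩
  refine h.2.1 ?_
  have := congrArg SimpleGraph.Walk.length hnil
  apply SimpleGraph.Walk.Nil.eq_nil
  rw [← SimpleGraph.Walk.length_eq_zero_iff]
  simp only [SimpleGraph.Walk.length_append, SimpleGraph.Walk.length_nil] at this ⊢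
  omega

/-- A cycle can be started at any of its vertices. -/
lemma exists_isCycle_of_mem_support {x y : V} {c : G.Walk x x} (hc : c.IsCycle)
    (hy : y ∈ c.support) : ∃ c' : G.Walk y y, c'.IsCycle ∧ c'.edges.Perm c.edges ∧
      ∀ z, z ∈ c'.support ↔ z ∈ c.support := by
  classical
  exact ⟨c.rotate y hy, hc.rotate hy, (c.rotate_edges y hy).perm,
    fun z => c.mem_support_rotate_iff y hy⟩

/-- Two vertices of a cycle split it into two paths that only have their ends in common. -/
lemma isPath_of_isCycle_append {x y : V} (hxy : x ≠ y) {v : G.Walk x y} {w : G.Walk y x}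
    (h : (v.append w).IsCycle) : v.IsPath ∧ w.IsPath ∧
      (∀ z, z ∈ v.support → z ∈ w.support → z = x ∨ z = y) ∧ v.edges.Disjoint w.edges := by
  refine ⟨h.isPath_of_append_left (SimpleGraph.Walk.not_nil_of_ne hxy.symm),
    h.isPath_of_append_right (SimpleGraph.Walk.not_nil_of_ne hxy), fun z hz hz' => ?_, ?_⟩
  · have hnd := h.support_nodup
    rw [SimpleGraph.Walk.tail_support_append] at hnd
    rw [SimpleGraph.Walk.mem_support_iff] at hz hz'
    rcases hz with hz | hz
    · exact Or.inl hz
    · rcases hz' with hz' | hz'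
      · exact Or.inr hz'
      · exact absurd hz' (List.disjoint_of_nodup_append hnd hz)
  · have hnd := h.edges_nodup
    rw [SimpleGraph.Walk.edges_append] at hnd
    exact List.disjoint_of_nodup_append hnd

lemma edges_disjoint_of_subsingleton {a b a' b' x : V} {v : G.Walk a b} {w : G.Walk a' b'}
    (h : ∀ z, z ∈ v.support → z ∈ w.support → z = x) : v.edges.Disjoint w.edges := by
  intro e he he'
  induction e with
  | _ s t =>
    have hadj := v.adj_of_mem_edges he
    refine hadj.ne ((h s ?_ ?_).trans (h t ?_ ?_).symm)
    exacts [v.fst_mem_support_of_mem_edges he, w.fst_mem_support_of_mem_edges he',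
      v.snd_mem_support_of_mem_edges he, w.snd_mem_support_of_mem_edges he']

/-- A path is determined by its start if it can only leave a vertex of `p` along `p`. -/
lemma eq_of_isPath {x y : V} {p s : G.Walk x y} (hp : p.IsPath) (hs : s.IsPath)
    (h : ∀ v ∈ p.support, v ≠ y → ∀ w, s(v, w) ∈ s.edges → s(v, w) ∈ p.edges) : s = p := by
  induction p with
  | nil => exact (SimpleGraph.Walk.isPath_iff_nil.1 hs).eq_nil
  | @cons x z y hxz p ih =>
    rw [SimpleGraph.Walk.cons_isPath_iff] at hp
    have hxy : x ≠ y := fun h' => hp.2 (h' ▸ p.end_mem_support)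
    cases s with
    | nil => exact absurd rfl hxy
    | @cons _ z' _ hxz' s =>
      rw [SimpleGraph.Walk.cons_isPath_iff] at hs
      have h1 := h x (SimpleGraph.Walk.start_mem_support _) hxy z' (by simp)
      obtain rfl : z' = z := by
        rw [SimpleGraph.Walk.edges_cons, List.mem_cons] at h1
        rcases h1 with h1 | h1
        · exact Sym2.congr_right.1 h1
        · exact absurd (p.fst_mem_support_of_mem_edges h1) hp.2
      rw [ih hp.1 hs.1 fun v hv hvy w hvw => ?_]
      have h2 := h v (by simp [hv]) hvy w (by simp [hvw])
      rw [SimpleGraph.Walk.edges_cons, List.mem_cons] at h2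
      refine h2.resolve_left fun h3 => ?_
      rw [h3] at hvw
      exact hs.2 (s.fst_mem_support_of_mem_edges hvw)

/-- Once on `p`, the path cannot change to `q` at an inner vertex, since `q` meets `p` only at the
ends, and it cannot return to `x`. -/
lemma eq_of_isPath_of_head_mem {x y z : V} {p q : G.Walk x y} (hp : p.IsPath)
    (hpq : ∀ z, z ∈ p.support → z ∈ q.support → z = x ∨ z = y) {h : G.Adj x z} {s : G.Walk z y}
    (hs : (SimpleGraph.Walk.cons h s).IsPath)
    (hsub : ∀ e ∈ s.edges, e ∈ p.edges ∨ e ∈ q.edges) (hz : s(x, z) ∈ p.edges) :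
    .cons h s = p := by
  refine eq_of_isPath hp hs fun v hv hvy w hvw => ?_
  rw [SimpleGraph.Walk.edges_cons, List.mem_cons] at hvw
  rcases hvw with hvw | hvw
  · rwa [hvw]
  · refine (hsub _ hvw).resolve_right fun hq => ?_
    rcases hpq v hv (q.fst_mem_support_of_mem_edges hq) with rfl | rfl
    · exact ((SimpleGraph.Walk.cons_isPath_iff _ _).1 hs).2 (s.fst_mem_support_of_mem_edges hvw)
    · exact hvy rfl

/-- A path within a cycle is one of its two arcs. -/
lemma eq_or_eq_of_isPath {x y : V} (hxy : x ≠ y) {p q s : G.Walk x y} (hp : p.IsPath)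
    (hq : q.IsPath) (hs : s.IsPath) (hpq : ∀ z, z ∈ p.support → z ∈ q.support → z = x ∨ z = y)
    (hsub : ∀ e ∈ s.edges, e ∈ p.edges ∨ e ∈ q.edges) : s = p ∨ s = q := by
  cases s with
  | nil => exact absurd rfl hxy
  | @cons _ z _ h s =>
    rcases hsub s(x, z) (by simp) with hz | hz
    · exact Or.inl (eq_of_isPath_of_head_mem hp hpq hs (fun e he => hsub e (by simp [he])) hz)
    · exact Or.inr (eq_of_isPath_of_head_mem hq (fun z h1 h2 => hpq z h2 h1) hs
        (fun e he => (hsub e (by simp [he])).symm) hz)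

/-! ### Ears -/

/-- `H` is connected with cyclomatic number `n`. -/
def HasCyclomaticNumber (H : G.Subgraph) (n : ℕ) : Prop :=
  H.Connected ∧ H.edgeSet.ncard + 1 = H.verts.ncard + n

lemma ncard_mem_of_nodup {α : Type*} {l : List α} (h : l.Nodup) : {a | a ∈ l}.ncard = l.length := by
  classical
  have : {a | a ∈ l} = (l.toFinset : Set α) := by ext; simp
  rw [this, Set.ncard_coe_finset, List.toFinset_card_of_nodup h]

lemma hasCyclomaticNumber_of_isPath {x y : V} {p : G.Walk x y} (hp : p.IsPath) :
    HasCyclomaticNumber p.toSubgraph 0 := by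
  refine ⟨p.toSubgraph_connected, ?_⟩
  have h1 : p.toSubgraph.edgeSet = {e | e ∈ p.edges} := by
    ext e
    exact SimpleGraph.Walk.mem_edges_toSubgraph p
  rw [h1, SimpleGraph.Walk.verts_toSubgraph, ncard_mem_of_nodup hp.isTrail.edges_nodup,
    ncard_mem_of_nodup hp.support_nodup, SimpleGraph.Walk.length_edges,
    SimpleGraph.Walk.length_support]

/-- An ear of length `k` adds `k` edges but only `k - 1` vertices: of the vertices after its start,
just `y` is already in `H`. Closed ears, with `x = y`, are allowed. -/
lemma HasCyclomaticNumber.sup_toSubgraph [Finite V] {H : G.Subgraph} {n : ℕ}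
    (h : HasCyclomaticNumber H n) {x y : V} {w : G.Walk x y} (hnil : ¬ w.Nil) (hx : x ∈ H.verts)
    (hy : y ∈ H.verts) (hV : w.support.tail.Nodup) (hE : w.edges.Nodup)
    (hint : ∀ z ∈ w.support.tail, z ∈ H.verts → z = y) (hdisj : ∀ e ∈ w.edges, e ∉ H.edgeSet) :
    HasCyclomaticNumber (H ⊔ w.toSubgraph) (n + 1) := by
  refine ⟨SimpleGraph.Subgraph.connected_sup h.1.preconnected w.toSubgraph_connected.preconnected
    ⟨x, hx, w.start_mem_verts_toSubgraph⟩, ?_⟩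
  have h1 : (H ⊔ w.toSubgraph).edgeSet = H.edgeSet ∪ {e | e ∈ w.edges} := by
    rw [SimpleGraph.Subgraph.edgeSet_sup]
    congr 1
    ext e
    exact SimpleGraph.Walk.mem_edges_toSubgraph w
  have h2 : (H ⊔ w.toSubgraph).verts = H.verts ∪ {z | z ∈ w.support.tail} := by
    rw [SimpleGraph.Subgraph.verts_sup, SimpleGraph.Walk.verts_toSubgraph]
    ext z
    simp only [Set.mem_union, Set.mem_ofPred_eq, SimpleGraph.Walk.mem_support_iff w]
    refine ⟨?_, Or.imp_right Or.inr⟩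
    rintro (hz | rfl | hz)
    exacts [Or.inl hz, Or.inl hx, Or.inr hz]
  have h3 : H.verts ∩ {z | z ∈ w.support.tail} = {y} := by
    ext z
    refine ⟨fun hz => hint z hz.2 hz.1, ?_⟩
    rintro rfl
    exact ⟨hy, w.end_mem_tail_support hnil⟩
  have h4 := Set.ncard_union_add_ncard_inter H.verts {z | z ∈ w.support.tail} (Set.toFinite _)
    (Set.toFinite _)
  have h5 : w.support.tail.length = w.length := by simp
  have h6 : Disjoint H.edgeSet {e | e ∈ w.edges} :=
    Set.disjoint_left.2 fun e he he' => hdisj e he' he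
  rw [h3, Set.ncard_singleton, ncard_mem_of_nodup hV, h5] at h4
  rw [h1, h2, Set.ncard_union_eq h6
    (Set.toFinite _) (Set.toFinite _), ncard_mem_of_nodup hE, SimpleGraph.Walk.length_edges]
  have := h.2
  omega

lemma IsBaseBicyclic.eq_top (hG : IsBaseBicyclic G) {H : G.Subgraph}
    (h : HasCyclomaticNumber H 2) : H = ⊤ := by
  refine hG.2 H ⟨h.1.coe, ?_⟩
  have h1 : H.edgeSet.ncard = H.coe.edgeSet.ncard := by
    rw [← SimpleGraph.Subgraph.image_coe_edgeSet_coe,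
      Set.ncard_image_of_injective _ (Sym2.map.injective Subtype.val_injective)]
  have h2 := h.2
  rw [← h1, Nat.card_coe_set_eq]
  omega

/-- A base bicyclic graph consists of any path together with two successive ears. -/
lemma IsBaseBicyclic.cover [Finite V] (hG : IsBaseBicyclic G) {a b x y x' y' : V}
    {p : G.Walk a b} {v : G.Walk x y} {w : G.Walk x' y'} (hp : p.IsPath)
    (hv : ¬ v.Nil) (hx : x ∈ p.support) (hy : y ∈ p.support)
    (hvV : v.support.tail.Nodup) (hvE : v.edges.Nodup)
    (hv₁ : ∀ z ∈ v.support.tail, z ∈ p.support → z = y) (hv₂ : v.edges.Disjoint p.edges)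
    (hw : ¬ w.Nil) (hx' : x' ∈ p.support ∨ x' ∈ v.support) (hy' : y' ∈ p.support ∨ y' ∈ v.support)
    (hwV : w.support.tail.Nodup) (hwE : w.edges.Nodup)
    (hw₁ : ∀ z ∈ w.support.tail, z ∈ p.support ∨ z ∈ v.support → z = y')
    (hw₂ : w.edges.Disjoint p.edges) (hw₃ : w.edges.Disjoint v.edges) :
    (∀ z, z ∈ p.support ∨ z ∈ v.support ∨ z ∈ w.support) ∧
      ∀ e ∈ G.edgeSet, e ∈ p.edges ∨ e ∈ v.edges ∨ e ∈ w.edges := by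
  have h1 := (hasCyclomaticNumber_of_isPath hp).sup_toSubgraph hv (p.mem_verts_toSubgraph.2 hx)
    (p.mem_verts_toSubgraph.2 hy) hvV hvE
    (fun z hz hz' => hv₁ z hz (p.mem_verts_toSubgraph.1 hz'))
    (fun e he he' => hv₂ he (p.mem_edges_toSubgraph.1 he'))
  have hverts : ∀ z, z ∈ (p.toSubgraph ⊔ v.toSubgraph).verts ↔ z ∈ p.support ∨ z ∈ v.support := by
    intro z
    rw [SimpleGraph.Subgraph.verts_sup, Set.mem_union, p.mem_verts_toSubgraph,
      v.mem_verts_toSubgraph]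
  have hedges : ∀ e, e ∈ (p.toSubgraph ⊔ v.toSubgraph).edgeSet ↔ e ∈ p.edges ∨ e ∈ v.edges := by
    intro e
    rw [SimpleGraph.Subgraph.edgeSet_sup, Set.mem_union, p.mem_edges_toSubgraph,
      v.mem_edges_toSubgraph]
  have h2 := hG.eq_top (h1.sup_toSubgraph hw ((hverts _).2 hx') ((hverts _).2 hy') hwV hwE
    (fun z hz hz' => hw₁ z hz ((hverts z).1 hz'))
    (fun e he he' => ((hedges e).1 he').elim (hw₂ he) (hw₃ he)))
  constructor
  · intro z
    have hz : z ∈ (p.toSubgraph ⊔ v.toSubgraph ⊔ w.toSubgraph).verts := by rw [h2]; trivial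
    rw [SimpleGraph.Subgraph.verts_sup, Set.mem_union, hverts, w.mem_verts_toSubgraph,
      or_assoc] at hz
    exact hz
  · intro e he
    have hz : e ∈ (p.toSubgraph ⊔ v.toSubgraph ⊔ w.toSubgraph).edgeSet := by rwa [h2]
    rw [SimpleGraph.Subgraph.edgeSet_sup, Set.mem_union, hedges, w.mem_edges_toSubgraph,
      or_assoc] at hz
    exact hz

/-! ### The three shapes -/

lemma ConsistsOfTheta.swap {x y : V} {p q r : G.Walk x y} (h : ConsistsOfTheta G p q r) :
    ConsistsOfTheta G q p r where
  ne := h.ne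
  isPath₁ := h.isPath₂
  isPath₂ := h.isPath₁
  isPath₃ := h.isPath₃
  inter₁₂ z h₁ h₂ := h.inter₁₂ z h₂ h₁
  inter₁₃ := h.inter₂₃
  inter₂₃ := h.inter₁₃
  disjoint₁₂ := h.disjoint₁₂.symm
  disjoint₁₃ := h.disjoint₂₃
  disjoint₂₃ := h.disjoint₁₃
  vertex z := by have := h.vertex z; tauto
  edge e he := by have := h.edge e he; tauto

variable [Finite V]

/-- A path between the cycles is cut at its first vertex on `d`, then, read backwards, at its first
vertex on `c`. The rotated cycles are closed ears at the ends of what remains. -/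
lemma IsBaseBicyclic.consistsOfBowtie (hG : IsBaseBicyclic G) {x y : V} {c : G.Walk x x}
    {d : G.Walk y y} (hc : c.IsCycle) (hd : d.IsCycle) (hcd : c.support.Disjoint d.support) :
    ∃ (x' y' : V) (p : G.Walk x' y') (c' : G.Walk x' x') (d' : G.Walk y' y'),
      ConsistsOfBowtie G p c' d' ∧ c'.edges.Perm c.edges ∧ d'.edges.Perm d.edges := by
  obtain ⟨w, hw⟩ := (hG.1.1 x y).exists_isPath
  obtain ⟨y', hy', v, v', rfl, hv⟩ := exists_append_of_end_mem {z | z ∈ d.support} w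
    d.start_mem_support
  obtain ⟨x', hx', t, t', hvt, ht⟩ := exists_append_of_end_mem {z | z ∈ c.support} v.reverse
    c.start_mem_support
  have hsub : ∀ z ∈ t.support, z ∈ v.support := by
    intro z hz
    have : z ∈ v.reverse.support := by
      rw [hvt, SimpleGraph.Walk.mem_support_append_iff]
      exact Or.inl hz
    simpa using this
  have htp : t.IsPath := by
    have := hw.of_append_left.reverse
    rw [hvt] at this
    exact this.of_append_left
  obtain ⟨c', hc', hce, hcs⟩ := exists_isCycle_of_mem_support hc hx'
  obtain ⟨d', hd', hde, hds⟩ := exists_isCycle_of_mem_support hd hy'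
  have h1 : ∀ z, z ∈ t.reverse.support → z ∈ c'.support → z = x' := by
    intro z hz hz'
    exact ht z (by simpa using hz) ((hcs z).1 hz')
  have h2 : ∀ z, z ∈ t.reverse.support → z ∈ d'.support → z = y' := by
    intro z hz hz'
    exact hv z (hsub z (by simpa using hz)) ((hds z).1 hz')
  have h3 : c'.support.Disjoint d'.support := fun z hz hz' => hcd ((hcs z).1 hz) ((hds z).1 hz')
  obtain ⟨hV, hE⟩ := hG.cover (p := t.reverse) (v := c') (w := d') htp.reverse hc'.not_nil
    (by simp) (by simp) hc'.support_nodup hc'.edges_nodup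
    (fun z hz hz' => h1 z hz' (List.mem_of_mem_tail hz))
    (edges_disjoint_of_subsingleton h1).symm hd'.not_nil (by simp) (by simp)
    hd'.support_nodup hd'.edges_nodup
    (fun z hz hz' => hz'.elim (fun h => h2 z h (List.mem_of_mem_tail hz))
      fun h => absurd (List.mem_of_mem_tail hz) (h3 h))
    (edges_disjoint_of_subsingleton h2).symm
    (edges_disjoint_of_subsingleton (x := x') fun z hz hz' => absurd hz (h3 hz'))
  exact ⟨x', y', t.reverse, c', d', ⟨htp.reverse, hc', hd', h3, h1, h2, hV, hE⟩, hce, hde⟩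

lemma IsBaseBicyclic.consistsOfInfty (hG : IsBaseBicyclic G) {x : V} {c d : G.Walk x x}
    (hc : c.IsCycle) (hd : d.IsCycle) (hcd : ∀ z, z ∈ c.support → z ∈ d.support → z = x) :
    ConsistsOfInfty G c d := by
  obtain ⟨hV, hE⟩ := hG.cover (p := (.nil : G.Walk x x)) (v := c) (w := d)
    SimpleGraph.Walk.IsPath.nil hc.not_nil (by simp) (by simp) hc.support_nodup hc.edges_nodup
    (by simp) (by simp) hd.not_nil (by simp) (by simp) hd.support_nodup hd.edges_nodup
    (fun z hz hz' => hz'.elim (by simp) fun h => hcd z h (List.mem_of_mem_tail hz))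
    (by simp) (edges_disjoint_of_subsingleton hcd).symm
  refine ⟨hc, hd, hcd, fun z => ?_, fun e he => ?_⟩
  · rcases hV z with h | h
    · rw [SimpleGraph.Walk.support_nil, List.mem_singleton] at h
      exact Or.inl (h ▸ c.start_mem_support)
    · exact h
  · simpa using hE e he

lemma IsBaseBicyclic.consistsOfTheta (hG : IsBaseBicyclic G) {x y : V} (hxy : x ≠ y)
    {p q r : G.Walk x y} (hc : (p.append q.reverse).IsCycle) (hr : r.IsPath)
    (hpr : ∀ z, z ∈ p.support → z ∈ r.support → z = x ∨ z = y)
    (hqr : ∀ z, z ∈ q.support → z ∈ r.support → z = x ∨ z = y)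
    (hpr' : p.edges.Disjoint r.edges) (hqr' : q.edges.Disjoint r.edges) :
    ConsistsOfTheta G p q r := by
  obtain ⟨hp, hq, hpq, hpq'⟩ := isPath_of_isCycle_append hxy hc
  have hsupp : ∀ z, z ∈ (p.append q.reverse).support ↔ z ∈ p.support ∨ z ∈ q.support := by
    intro z
    simp [SimpleGraph.Walk.mem_support_append_iff]
  -- The cycle is a closed ear on the trivial path at `x`, and `r` is the second ear.
  obtain ⟨hV, hE⟩ := hG.cover (p := (.nil : G.Walk x x)) (v := p.append q.reverse) (w := r)
    SimpleGraph.Walk.IsPath.nil hc.not_nil (by simp) (by simp) hc.support_nodup hc.edges_nodup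
    (by simp) (by simp) (SimpleGraph.Walk.not_nil_of_ne hxy) (by simp)
    (Or.inr ((hsupp y).2 (by simp)))
    (nodup_tail_of_isPath hr).1 hr.isTrail.edges_nodup
    (fun z hz hz' => by
      have hzx : z ≠ x := by
        rintro rfl
        exact hxy ((nodup_tail_of_isPath hr).2 hz)
      refine (?_ : z = x ∨ z = y).resolve_left hzx
      rw [hsupp] at hz'
      rcases hz' with h | h | h
      · exact Or.inl (by simpa using h)
      · exact hpr z h (List.mem_of_mem_tail hz)
      · exact hqr z h (List.mem_of_mem_tail hz))
    (by simp)
    (fun e he he' => by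
      rw [SimpleGraph.Walk.edges_append, List.mem_append, SimpleGraph.Walk.edges_reverse,
        List.mem_reverse] at he'
      rcases he' with h | h
      exacts [hpr' h he, hqr' h he])
  refine ⟨hxy, hp, by simpa using hq, hr, by simpa using hpq, hpr, hqr, by simpa using hpq', hpr',
    hqr', fun z => ?_, fun e he => ?_⟩
  · rcases hV z with h | h | h
    · rw [SimpleGraph.Walk.support_nil, List.mem_singleton] at h
      exact Or.inl (h ▸ p.start_mem_support)
    · rw [hsupp] at h
      tauto
    · tauto
  · have := hE e he
    simp only [SimpleGraph.Walk.edges_nil, List.not_mem_nil, false_or,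
      SimpleGraph.Walk.edges_append, List.mem_append, SimpleGraph.Walk.edges_reverse,
      List.mem_reverse] at this
    tauto

/-- Two cycles of a base bicyclic graph determine its shape. -/
lemma IsBaseBicyclic.exists_shape (hG : IsBaseBicyclic G) {x₀ y₀ : V} {c₀ : G.Walk x₀ x₀}
    {d₀ : G.Walk y₀ y₀} (hc₀ : c₀.IsCycle) (hd₀ : d₀.IsCycle)
    (hne : ∃ e ∈ d₀.edges, e ∉ c₀.edges) :
    (∃ (x y : V) (p q r : G.Walk x y), ConsistsOfTheta G p q r ∧
      (p.edges ++ q.edges).Perm c₀.edges ∧ (p.edges ++ r.edges).Perm d₀.edges) ∨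
    (∃ (x : V) (c d : G.Walk x x), ConsistsOfInfty G c d ∧
      c.edges.Perm c₀.edges ∧ d.edges.Perm d₀.edges) ∨
    ∃ (x y : V) (p : G.Walk x y) (c : G.Walk x x) (d : G.Walk y y), ConsistsOfBowtie G p c d ∧
      c.edges.Perm c₀.edges ∧ d.edges.Perm d₀.edges := by
  classical
  by_cases hcd : c₀.support.Disjoint d₀.support
  · exact Or.inr (Or.inr (hG.consistsOfBowtie hc₀ hd₀ hcd))
  obtain ⟨u, huc, hud⟩ : ∃ u, u ∈ c₀.support ∧ u ∈ d₀.support := by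
    simpa [List.Disjoint] using hcd
  obtain ⟨d₁, hd₁, hd₁e, -⟩ := exists_isCycle_of_mem_support hd₀ hud
  -- From a common vertex, follow the second cycle to the first edge that leaves the first one, at
  -- `x`, and restart it there.
  obtain ⟨x, hx, z, hxz, v, v', rfl, hxzE⟩ := exists_append_cons_of_notMem
    (S := {z | z ∈ c₀.support}) (E := {e | e ∈ c₀.edges})
    (fun e he t ht => c₀.mem_support_of_mem_edges he ht) d₁ huc (by
      obtain ⟨e, he, he'⟩ := hne
      exact ⟨e, hd₁e.mem_iff.2 he, he'⟩)
  have hd := isCycle_append_comm hd₁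
  have hde : ((SimpleGraph.Walk.cons hxz v').append v).edges.Perm d₀.edges := by
    refine List.Perm.trans ?_ hd₁e
    rw [SimpleGraph.Walk.edges_append, SimpleGraph.Walk.edges_append]
    exact List.perm_append_comm
  obtain ⟨c, hc, hce, hcs⟩ := exists_isCycle_of_mem_support hc₀ hx
  rw [SimpleGraph.Walk.cons_append] at hd hde
  -- At `y` the second cycle first returns to `c₀`. If `y = x`, this excursion is the whole cycle;
  -- otherwise it is an ear giving a theta graph.
  obtain ⟨y, hy, a, b, hab, ha⟩ := exists_append_of_end_mem {z | z ∈ c₀.support} (v'.append v) hx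
  rw [hab] at hd hde
  by_cases hxy : x = y
  · subst hxy
    have hpath := ((SimpleGraph.Walk.cons_isCycle_iff _ _).1 hd).1
    have hb : b = .nil := (SimpleGraph.Walk.isPath_iff_nil.1 hpath.of_append_right).eq_nil
    rw [hb, SimpleGraph.Walk.append_nil] at hd hde
    refine Or.inr (Or.inl ⟨x, c, _, hG.consistsOfInfty hc hd fun t ht ht' => ?_, hce, hde⟩)
    rw [SimpleGraph.Walk.support_cons, List.mem_cons] at ht'
    exact ht'.elim id fun h => ha t h ((hcs t).1 ht)
  · rw [← SimpleGraph.Walk.cons_append] at hd hde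
    set r := SimpleGraph.Walk.cons hxz a with hr
    obtain ⟨hrp, hbp, hrb, hrb'⟩ := isPath_of_isCycle_append hxy hd
    have hrc : ∀ t, t ∈ c.support → t ∈ r.support → t = x ∨ t = y := by
      intro t ht ht'
      rw [hr, SimpleGraph.Walk.support_cons, List.mem_cons] at ht'
      exact ht'.imp id fun h => ha t h ((hcs t).1 ht)
    have hrc' : c.edges.Disjoint r.edges := by
      intro e he he'
      rw [hr, SimpleGraph.Walk.edges_cons, List.mem_cons] at he'
      rcases he' with rfl | he'
      · exact hxzE (hce.mem_iff.1 he)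
      · exact edges_disjoint_of_subsingleton (fun t ht ht' => ha t ht ((hcs t).1 ht')) he' he
    have hyc : y ∈ c.support := (hcs y).2 hy
    obtain ⟨p, q, hpq⟩ : ∃ p q : G.Walk x y, c = p.append q.reverse :=
      ⟨c.takeUntil y hyc, (c.dropUntil y hyc).reverse, by simp⟩
    rw [hpq] at hc hce hrc hrc'
    have hθ := hG.consistsOfTheta hxy hc hrp
      (fun t ht => hrc t (by simp [SimpleGraph.Walk.mem_support_append_iff, ht]))
      (fun t ht => hrc t (by simp [SimpleGraph.Walk.mem_support_append_iff, ht]))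
      (fun e he => hrc' (by simp [he])) (fun e he => hrc' (by simp [he]))
    have hce' : (p.edges ++ q.edges).Perm c₀.edges := by
      refine List.Perm.trans ?_ hce
      rw [SimpleGraph.Walk.edges_append, SimpleGraph.Walk.edges_reverse]
      exact (List.reverse_perm _).symm.append_left _
    have hde' : (b.reverse.edges ++ r.edges).Perm d₀.edges := by
      refine List.Perm.trans ?_ hde
      rw [SimpleGraph.Walk.edges_append, SimpleGraph.Walk.edges_reverse]
      exact ((List.reverse_perm _).append_right _).trans List.perm_append_comm
    refine Or.inl ⟨x, y, ?_⟩
    -- The rest `b` of the second cycle avoids the edges of `r`, so it is one of the two arcs of the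
    -- first cycle.
    rcases eq_or_eq_of_isPath hxy hθ.isPath₁ hθ.isPath₂ hbp.reverse hθ.inter₁₂ (fun e he => by
      rw [SimpleGraph.Walk.edges_reverse, List.mem_reverse] at he
      have h1 := hθ.edge e (b.edges_subset_edgeSet he)
      have h2 : e ∉ r.edges := fun h => hrb' h he
      tauto) with hs | hs
    · rw [hs] at hde'
      exact ⟨p, q, r, hθ, hce', hde'⟩
    · rw [hs] at hde'
      exact ⟨q, p, r, hθ.swap, List.perm_append_comm.trans hce', hde'⟩

end

/-! ### From spectral symmetry to the family -/

section

variable {V : Type u} {G : SimpleGraph V}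

open Signature

/-- A spectrally symmetric signature of a non-bipartite base bicyclic graph belongs to the family:
there are two shortest odd cycles of opposite sign, and these determine the graph. -/
lemma mem_family_of_isSpectrallySymmetric [Fintype V] (hG : IsBaseBicyclic G)
    (hbip : ¬ G.IsBipartite) {σ : Signature G} (hσ : σ.IsSpectrallySymmetric) : σ ∈ family G := by
  classical
  have hex : ∃ n, Odd n ∧ ∃ (x : V) (w : G.Walk x x), w.length = n := by
    by_contra! hcon
    refine hbip (SimpleGraph.two_colorable_iff_forall_loop_even.2 fun x w => ?_)
    exact Nat.not_odd_iff_even.1 fun h => hcon _ h x w rfl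
  obtain ⟨hodd, x₀, w₀, hw₀⟩ := Nat.find_spec hex
  have hcycle : ∀ {x : V} (w : G.Walk x x), w.length = w₀.length → w.IsCycle := fun w hw =>
    isCycle_of_odd_of_minimal (by rwa [hw, hw₀]) fun y v hv => by
      rw [hw, hw₀]
      exact Nat.find_min' hex ⟨hv, y, v, rfl⟩
  rw [← hw₀] at hodd
  obtain ⟨i, hi⟩ := id hodd
  have hi1 : 1 ≤ i := by
    have := (hcycle w₀ rfl).three_le_length
    omega
  obtain ⟨x₁, c₀, hcl, hcσ⟩ := exists_closed_walk_of_isSpectrallySymmetric hσ hodd (-1)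
  obtain ⟨x₂, d₀, hdl, hdσ⟩ := exists_closed_walk_of_isSpectrallySymmetric hσ hodd 1
  have hc₀ := hcycle c₀ hcl
  have hd₀ := hcycle d₀ hdl
  -- Cycles of equal length with nested edge sets have the same edges, hence the same sign.
  have hne : ∃ e ∈ d₀.edges, e ∉ c₀.edges := by
    by_contra! hsub
    have hperm : d₀.edges.Perm c₀.edges :=
      (List.subperm_of_subset hd₀.edges_nodup hsub).perm_of_length_le (by simp [hcl, hdl])
    have := σ.walkSign_eq_of_perm hperm
    rw [hcσ, hdσ] at this
    exact absurd this (by decide)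
  have hlen : ∀ {x x' : V} {c : G.Walk x x} {c' : G.Walk x' x'}, c.edges.Perm c'.edges →
      c.length = c'.length := fun h => by simpa using h.length_eq
  rcases hG.exists_shape hc₀ hd₀ hne with ⟨x, y, p, q, r, h, hpq, hpr⟩ | ⟨x, c, d, h, hc, hd⟩ |
    ⟨x, y, p, c, d, h, hc, hd⟩ <;> obtain ⟨f, hf⟩ := h.exists_potential σ
  · have hq : σ.walkSign p * σ.walkSign q = -1 := by
      rw [← hcσ, walkSign, walkSign, walkSign, ← List.prod_append, ← List.map_append]
      exact (hpq.map _).prod_eq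
    have hr : σ.walkSign p * σ.walkSign r = 1 := by
      rw [← hdσ, walkSign, walkSign, walkSign, ← List.prod_append, ← List.map_append]
      exact (hpr.map _).prod_eq
    -- Both short cycles contain `p`, so `q` and `r` have equal length, of parity opposite to that
    -- of `p`.
    have hql : p.length + q.length = 2 * i + 1 := by
      have := hpq.length_eq
      simp only [List.length_append, SimpleGraph.Walk.length_edges] at this
      omega
    have hrl : p.length + r.length = 2 * i + 1 := by
      have := hpr.length_eq
      simp only [List.length_append, SimpleGraph.Walk.length_edges] at this
      omega
    have hpos : ∀ w : G.Walk x y, 1 ≤ w.length := fun w =>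
      Nat.one_le_iff_ne_zero.2 fun h0 => h.ne (SimpleGraph.Walk.eq_of_length_eq_zero h0)
    rw [hq, hr] at hf
    refine Or.inl (Or.inl ⟨_, ⟨_, rfl⟩, x, y, p.length, q.length, hpos p, hpos q, ?_,
      p, q, r, h, rfl, rfl, by omega, hf⟩)
    rw [Nat.even_iff, Nat.odd_iff]
    omega
  · rw [σ.walkSign_eq_of_perm hc, σ.walkSign_eq_of_perm hd, hcσ, hdσ] at hf
    exact Or.inl (Or.inr ⟨_, ⟨_, rfl⟩, x, i, hi1, c, d, h, by rw [hlen hc, hcl, hi],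
      by rw [hlen hd, hdl, hi], hf⟩)
  · rw [σ.walkSign_eq_of_perm hc, σ.walkSign_eq_of_perm hd, hcσ, hdσ] at hf
    have hxy : x ≠ y := by
      rintro rfl
      exact h.disjoint c.start_mem_support d.start_mem_support
    exact Or.inr ⟨_, ⟨_, rfl⟩, x, y, p.length, i, Nat.one_le_iff_ne_zero.2 fun h0 =>
      hxy (SimpleGraph.Walk.eq_of_length_eq_zero h0), hi1, p, c, d, h, rfl,
      by rw [hlen hc, hcl, hi], by rw [hlen hd, hdl, hi], hf⟩

end

end SignedBicyclic

theorem mainTheorem3 {V : Type*} [Fintype V] (G : SimpleGraph V)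
    (hG : SignedBicyclic.IsBaseBicyclic G) (hbip : ¬ G.IsBipartite)
    (σ : SignedBicyclic.Signature G) :
    (σ.IsSpectrallySymmetric ↔ σ ∈ SignedBicyclic.family G) ∧
      (σ ∈ SignedBicyclic.family G ↔ σ.IsSignSymmetric) := by
  have h₁ := fun h => SignedBicyclic.mem_family_of_isSpectrallySymmetric hG hbip (σ := σ) h
  have h₂ := SignedBicyclic.isSignSymmetric_of_mem_family (σ := σ)
  have h₃ := SignedBicyclic.Signature.isSpectrallySymmetric_of_isSignSymmetric (σ := σ)
  exact ⟨⟨h₁, fun h => h₃ (h₂ h)⟩, ⟨h₂, fun h => h₁ (h₃ h)⟩⟩
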